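/- Let $p$ be an odd positive integer and $(y_i,x_i)_{i\ge1}$ i.i.d. real pairs, where $x_i$ has bounded support $\mathbb S_x$ and a density $f$ that is continuous on $\mathbb S_x$. Put $g(t)=\mathrm E[y_i|x_i=t]$ and $\sigma^2(t)=\mathrm{Var}[y_i|x_i=t]$. Fix $\mathsf x\in\mathbb S_x$ and an open neighbourhood $\mathsf N$ of $\mathsf x$, and suppose that on $\mathsf N\cap\mathbb S_x$: $f>0$; $\sigma^2>0$ is continuous and $\mathrm E[y_i^4|x_i=t]$ is bounded; $g$ is $p+1$ times continuously differentiable (one-sidedly at a boundary point) and $g^{(p+1)}$ is Hölder continuous with some exponent $\eta>0$. Let $K$ be a symmetric function that vanishes outside $(-1,1)$ and is positive and Lipschitz continuous on $(-1,1)$. Let $h=h_n>0$ satisfy $h+(nh)^{-1}\log n\to0$ and $nh^{2p+3}\to\kappa\in[0,\infty)$. *Estimators.* With $r_q(u)=(1,u,\dots,u^q)'$ and $\iota_0=(1,0,\dots,0)'$ let $$\Gamma_q(t)=\frac1{nh}\sum_{i=1}^n K\Big(\frac{x_i-t}h\Big)r_q\Big(\frac{x_i-t}h\Big)r_q\Big(\frac{x_i-t}h\Big)',\qquad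 w_i(t)=\iota_0'\Gamma_p(t)^{-1}r_p\Big(\frac{x_i-t}h\Big)K\Big(\frac{x_i-t}h\Big),$$ $$w_{\mathsf{LP\text-bc},i}=\frac1{nh}\sum_{j=1}^n w_j(\mathsf x)w_i(x_j)-w_i(\mathsf x),\qquad C_n(t)=\frac1{nh}\sum_{i=1}^n w_i(t)\Big(\frac{x_i-t}h\Big)^{p+1},\qquad Q_n=\frac{C_n(\mathsf x)}{(nh)^{-1}\sum_i w_i(\mathsf x)C_n(x_i)},$$ $w_{\mathsf{PLP},i}=w_i(\mathsf x)-w_{\mathsf{LP\text-bc},i}$ and $w_{\mathsf{mPLP},i}=w_i(\mathsf x)-Q_nw_{\mathsf{LP\text-bc},i}$. Let $\hat\beta_{p+1}$ be the coefficient vector of the local polynomial regression of order $p+1$ at $\mathsf x$ with kernel $K$ and bandwidth $h$, and let $\tilde\varepsilon_i$ be its HC$k$ residuals, $k\in\{0,1,2,3\}$: $\tilde\varepsilon_i=\sqrt{\omega_i}\,\big(y_i-r_{p+1}(x_i-\mathsf x)'\hat\beta_{p+1}\big)$ with $\omega_i=1,\ \frac n{n-(p+2)},\ \frac1{1-\ell_i},\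 \frac1{(1-\ell_i)^2}$ for $k=0,1,2,3$, where $\ell_i$ is the leverage of observation $i$ in this regression. Put $$\hat v^2_{\mathsf{PLP},n}=\frac1{nh}\sum_{i=1}^n w_{\mathsf{PLP},i}^2\tilde\varepsilon_i^2,\qquad \hat v^2_{\mathsf{mPLP},n}=\frac1{nh}\sum_{i=1}^n w_{\mathsf{mPLP},i}^2\tilde\varepsilon_i^2 .$$ *Limits.* Let $\mathsf w(u)=\iota_0'\big(\int_{\mathbb R} r_pr_p'K\big)^{-1}r_p(u)K(u)$, $\mathsf w_{\mathsf{conv}}(u)=\int_{\mathbb R}\mathsf w(r)\mathsf w(u-r)\,dr$ and $$v^2_{\mathsf{PLP}}=\frac{\sigma^2(\mathsf x)}{f(\mathsf x)}\int_{\mathbb R}\big(2\mathsf w(u)-\mathsf w_{\mathsf{conv}}(u)\big)^2du .$$ Let $\mathsf w_{\mathsf{bnd}}(u,s)=\iota_0'\big(\int_{-s}^1 r_pr_p'K\big)^{-1}r_p(u)K(u)$, $\mathsf w_0(u)=\mathsf w_{\mathsf{bnd}}(u,0)$, $\mathsf w_{\mathsf{conv,bnd}}(u)=\int_0^\infty\mathsf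 w_{\mathsf{bnd}}(r,0)\mathsf w_{\mathsf{bnd}}(u-r,r)\,dr$, $C=\int_0^\infty\mathsf w_0(u)u^{p+1}du$, $C_{\mathsf{LP}}=\int_0^1\mathsf w_0(s)\int_{-s}^1\mathsf w_{\mathsf{bnd}}(u,s)u^{p+1}\,du\,ds$, $Q=C/C_{\mathsf{LP}}$ and $$v^2_{\mathsf{mPLP,bnd}}=\frac{\sigma^2(\mathsf x)}{f(\mathsf x)}\int_0^\infty\big(\mathsf w_0(u)-Q(\mathsf w_{\mathsf{conv,bnd}}(u)-\mathsf w_0(u))\big)^2du .$$ *Claim*, for each $k\in\{0,1,2,3\}$. (i) If $\mathsf x$ is an interior point of $\mathbb S_x$, then $v^2_{\mathsf{PLP}}>0$, and both $\hat v^2_{\mathsf{PLP},n}$ and $\hat v^2_{\mathsf{mPLP},n}$ converge in probability to $v^2_{\mathsf{PLP}}=:v^2_{\mathsf{mPLP}}$. (ii) If $\mathsf x$ is a left boundary point of $\mathbb S_x$ (near $\mathsf x$, $\mathbb S_x$ equals $[\mathsf x,\infty)$) and $C_{\mathsf{LP}}\ne0$, so that $Q$ is defined, then $v^2_{\mathsf{mPLP}}:=v^2_{\mathsf{mPLP,bnd}}>0$,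 and $\hat v^2_{\mathsf{mPLP},n}$ converges in probability to it. -/

import Mathlib

open MeasureTheory ProbabilityTheory Filter Topology Set
open scoped NNReal ENNReal

noncomputable section

namespace LocPoly

/-! ### Local polynomial estimators

A sample is a pair of sequences `X Y : ℕ → ℝ`, of which the first `n` terms are used;
`K` is the kernel, `h` the bandwidth and `q` or `p` the polynomial order. -/

/-- The vector `r_q(u) = (1, u, …, u^q)`. -/
def rVec (q : ℕ) (u : ℝ) : Fin (q + 1) → ℝ := fun j => u ^ (j : ℕ)

/-- `Γ_q(t) = (1/n) Z_q(t)' W(t) Z_q(t)`: its `(j, k)` entry is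
`(nh)⁻¹ ∑ᵢ K((xᵢ - t)/h) ((xᵢ - t)/h)^(j+k)`. -/
def gramMatrix (K : ℝ → ℝ) (q n : ℕ) (h : ℝ) (X : ℕ → ℝ) (t : ℝ) :
    Matrix (Fin (q + 1)) (Fin (q + 1)) ℝ :=
  Matrix.of fun j k => (n * h)⁻¹ *
    ∑ i ∈ Finset.range n, K ((X i - t) / h) * ((X i - t) / h) ^ ((j : ℕ) + (k : ℕ))

/-- The weight `w_i(t) = ι₀' Γ_p(t)⁻¹ r_p((xᵢ - t)/h) K((xᵢ - t)/h)`. -/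
def weight (K : ℝ → ℝ) (p n : ℕ) (h : ℝ) (X : ℕ → ℝ) (i : ℕ) (t : ℝ) : ℝ :=
  ((gramMatrix K p n h X t)⁻¹.mulVec (rVec p ((X i - t) / h))) 0 * K ((X i - t) / h)

/-- The local polynomial coefficients
`β̂_q(t) = H_q (Z_q' W Z_q)⁻¹ Z_q' W y`, where `H_q = diag(1, h⁻¹, …, h^(-q))`. -/
def betaHat (K : ℝ → ℝ) (q n : ℕ) (h : ℝ) (X Y : ℕ → ℝ) (t : ℝ) : Fin (q + 1) → ℝ :=
  fun j => (h ^ (j : ℕ))⁻¹ * ((gramMatrix K q n h X t)⁻¹.mulVec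
    (fun k => (n * h)⁻¹ * ∑ i ∈ Finset.range n,
      K ((X i - t) / h) * rVec q ((X i - t) / h) k * Y i)) j

/-- The residual `yᵢ - r_{p+1}(xᵢ - t)' β̂_{p+1}(t)` of the local polynomial fit of order `p + 1`
at the point `t`. -/
def bcResidual (K : ℝ → ℝ) (p n : ℕ) (h : ℝ) (X Y : ℕ → ℝ) (t : ℝ) (i : ℕ) : ℝ :=
  Y i - ∑ j : Fin (p + 2), rVec (p + 1) (X i - t) j * betaHat K (p + 1) n h X Y t j

/-- The leverage of observation `i` in the local polynomial fit of order `p + 1` at `t`: the `i`-th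
diagonal entry of `Z (Z' W Z)⁻¹ Z' W`, where `Z = Z_{p+1}(t)`. -/
def leverage (K : ℝ → ℝ) (p n : ℕ) (h : ℝ) (X : ℕ → ℝ) (t : ℝ) (i : ℕ) : ℝ :=
  (n * h)⁻¹ * (∑ j : Fin (p + 2), rVec (p + 1) ((X i - t) / h) j *
    ((gramMatrix K (p + 1) n h X t)⁻¹.mulVec (rVec (p + 1) ((X i - t) / h))) j) *
    K ((X i - t) / h)

/-- The four heteroskedasticity-consistent residual corrections. -/
inductive HCType
  | HC0
  | HC1
  | HC2
  | HC3

/-- The factor that multiplies the squared residual: none for HC0, the degrees-of-freedom correction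
`n / (n - (p + 2))` for HC1 (the fit of order `p + 1` has `p + 2` coefficients), and the leverage
corrections for HC2 and HC3. -/
def hcFactor (k : HCType) (K : ℝ → ℝ) (p n : ℕ) (h : ℝ) (X : ℕ → ℝ) (t : ℝ) (i : ℕ) : ℝ :=
  match k with
  | .HC0 => 1
  | .HC1 => (n : ℝ) / ((n : ℝ) - ((p : ℝ) + 2))
  | .HC2 => (1 - leverage K p n h X t i)⁻¹
  | .HC3 => ((1 - leverage K p n h X t i) ^ 2)⁻¹

/-- The bias-corrected HCk residual `ε̃ᵢ`. -/
def hcResidual (k : HCType) (K : ℝ → ℝ) (p n : ℕ) (h : ℝ) (X Y : ℕ → ℝ) (t : ℝ) (i : ℕ) : ℝ :=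
  Real.sqrt (hcFactor k K p n h X t i) * bcResidual K p n h X Y t i

/-- `w_{LP-bc,i}(t) = (nh)⁻¹ ∑ⱼ wⱼ(t) wᵢ(xⱼ) - wᵢ(t)`. -/
def weightLPbc (K : ℝ → ℝ) (p n : ℕ) (h : ℝ) (X : ℕ → ℝ) (i : ℕ) (t : ℝ) : ℝ :=
  (n * h)⁻¹ * (∑ j ∈ Finset.range n, weight K p n h X j t * weight K p n h X i (X j))
    - weight K p n h X i t

/-- `w_{PLP,i}(t) = wᵢ(t) - w_{LP-bc,i}(t)`. -/
def weightPLP (K : ℝ → ℝ) (p n : ℕ) (h : ℝ) (X : ℕ → ℝ) (i : ℕ) (t : ℝ) : ℝ :=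
  weight K p n h X i t - weightLPbc K p n h X i t

/-- `C_n(t) = ι₀' (Z_p' W Z_p)⁻¹ Z_p' W Z_{p+1} ι_{p+1}`, that is,
`(nh)⁻¹ ∑ᵢ wᵢ(t) ((xᵢ - t)/h)^(p+1)`. -/
def Cn (K : ℝ → ℝ) (p n : ℕ) (h : ℝ) (X : ℕ → ℝ) (t : ℝ) : ℝ :=
  (n * h)⁻¹ * ∑ i ∈ Finset.range n, weight K p n h X i t * ((X i - t) / h) ^ (p + 1)

/-- `C_{LP,n}(t) = (nh)⁻¹ ∑ᵢ wᵢ(t) C_n(xᵢ)`. -/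
def CLPn (K : ℝ → ℝ) (p n : ℕ) (h : ℝ) (X : ℕ → ℝ) (t : ℝ) : ℝ :=
  (n * h)⁻¹ * ∑ i ∈ Finset.range n, weight K p n h X i t * Cn K p n h X (X i)

/-- The scaling factor `Q_n = C_n / C_{LP,n}`. -/
def Qn (K : ℝ → ℝ) (p n : ℕ) (h : ℝ) (X : ℕ → ℝ) (t : ℝ) : ℝ :=
  Cn K p n h X t / CLPn K p n h X t

/-- `w_{mPLP,i}(t) = wᵢ(t) - Q_n w_{LP-bc,i}(t)`. -/
def weightMPLP (K : ℝ → ℝ) (p n : ℕ) (h : ℝ) (X : ℕ → ℝ) (i : ℕ) (t : ℝ) : ℝ :=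
  weight K p n h X i t - Qn K p n h X t * weightLPbc K p n h X i t

/-- The estimator `v̂²_{PLP,n}` at the evaluation point `t`, with HCk residuals. -/
def vHatSqPLP (k : HCType) (K : ℝ → ℝ) (p n : ℕ) (h : ℝ) (X Y : ℕ → ℝ) (t : ℝ) : ℝ :=
  (n * h)⁻¹ * ∑ i ∈ Finset.range n,
    weightPLP K p n h X i t ^ 2 * hcResidual k K p n h X Y t i ^ 2

/-- The estimator `v̂²_{mPLP,n}` at the evaluation point `t`, with HCk residuals. -/
def vHatSqMPLP (k : HCType) (K : ℝ → ℝ) (p n : ℕ) (h : ℝ) (X Y : ℕ → ℝ) (t : ℝ) : ℝ :=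
  (n * h)⁻¹ * ∑ i ∈ Finset.range n,
    weightMPLP K p n h X i t ^ 2 * hcResidual k K p n h X Y t i ^ 2

/-! ### Equivalent kernels and limiting variances -/

/-- The matrix `∫_A r_p(v) r_p(v)' K(v) dv`. -/
def kernelMoment (K : ℝ → ℝ) (p : ℕ) (A : Set ℝ) : Matrix (Fin (p + 1)) (Fin (p + 1)) ℝ :=
  Matrix.of fun j k => ∫ v in A, v ^ ((j : ℕ) + (k : ℕ)) * K v

/-- The equivalent kernel `ι₀' (∫_A r_p(v) r_p(v)' K(v) dv)⁻¹ r_p(u) K(u)`. -/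
def eqKernel (K : ℝ → ℝ) (p : ℕ) (A : Set ℝ) (u : ℝ) : ℝ :=
  ((kernelMoment K p A)⁻¹.mulVec (rVec p u)) 0 * K u

/-- The interior equivalent kernel. -/
def wInt (K : ℝ → ℝ) (p : ℕ) (u : ℝ) : ℝ := eqKernel K p univ u

/-- `w_conv(u) = ∫ w(r) w(u - r) dr`. -/
def wConv (K : ℝ → ℝ) (p : ℕ) (u : ℝ) : ℝ := ∫ r, wInt K p r * wInt K p (u - r)

/-- `w_PLP = w - (w_conv - w)`. -/
def wPLP (K : ℝ → ℝ) (p : ℕ) (u : ℝ) : ℝ := wInt K p u - (wConv K p u - wInt K p u)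

/-- The boundary equivalent kernel `w_bnd(u, s)`, with moments over `[-s, 1]`. -/
def wBnd (K : ℝ → ℝ) (p : ℕ) (u s : ℝ) : ℝ := eqKernel K p (Icc (-s) 1) u

/-- `w_{conv,bnd}(u) = ∫_{[0,∞)} w_bnd(r, 0) w_bnd(u - r, r) dr`. -/
def wConvBnd (K : ℝ → ℝ) (p : ℕ) (u : ℝ) : ℝ :=
  ∫ r in Ici (0 : ℝ), wBnd K p r 0 * wBnd K p (u - r) r

/-- The boundary constant `C = ∫_{[0,∞)} w_bnd(u, 0) u^(p+1) du`. -/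
def CBnd (K : ℝ → ℝ) (p : ℕ) : ℝ := ∫ u in Ici (0 : ℝ), wBnd K p u 0 * u ^ (p + 1)

/-- `C_LP = ∫_0^1 w_bnd(s, 0) ∫_{-s}^1 w_bnd(u, s) u^(p+1) du ds`. -/
def CLPBnd (K : ℝ → ℝ) (p : ℕ) : ℝ :=
  ∫ s in (0 : ℝ)..1, wBnd K p s 0 * ∫ u in (-s)..1, wBnd K p u s * u ^ (p + 1)

/-- `w_mPLP = w - Q (w_{conv,bnd} - w)` at a boundary point, where `Q = C / C_LP`. -/
def wMPLPBnd (K : ℝ → ℝ) (p : ℕ) (u : ℝ) : ℝ :=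
  wBnd K p u 0 - CBnd K p / CLPBnd K p * (wConvBnd K p u - wBnd K p u 0)

/-- `v²_PLP`, as a function of `fx = f(x)` and `sx = σ²(x)`, at an interior point `x`. -/
def vSqPLP (K : ℝ → ℝ) (p : ℕ) (fx sx : ℝ) : ℝ := sx / fx * ∫ u, wPLP K p u ^ 2

/-- `v²_mPLP`, as a function of `fx = f(x)` and `sx = σ²(x)`, at a boundary point `x`. -/
def vSqMPLPBnd (K : ℝ → ℝ) (p : ℕ) (fx sx : ℝ) : ℝ :=
  sx / fx * ∫ u in Ici (0 : ℝ), wMPLPBnd K p u ^ 2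

/-! ### Assumptions -/

/-- `t` is an interior point of `S`. -/
def IsInteriorPoint (S : Set ℝ) (t : ℝ) : Prop := t ∈ interior S

/-- `t` is a (left) boundary point of `S`: near `t`, the set `S` is `[t, ∞)`. -/
def IsLeftBoundaryPoint (S : Set ℝ) (t : ℝ) : Prop :=
  ∃ δ > 0, S ∩ Ioo (t - δ) (t + δ) = Ico t (t + δ)

/-- The sampling assumption. `(xᵢ, yᵢ)` are i.i.d., `xᵢ` has bounded support `S` and a density `f`
that is continuous on `S`; `g(t) = E[yᵢ | xᵢ = t]`; and on `N ∩ S`, where `N` is an open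
neighbourhood of the evaluation point `t₀`: `f > 0`; `σ²(t) = Var[yᵢ | xᵢ = t]` is positive and
continuous; `E[yᵢ⁴ | xᵢ = t]` is bounded; and `g` has a Hölder continuous derivative of order
`p + 1`. Conditional moments are moments of the regular conditional distribution. -/
structure SamplingAssumption {Ω : Type*} [MeasurableSpace Ω] (P : Measure Ω)
    [IsProbabilityMeasure P] (x y : ℕ → Ω → ℝ) (f g σ2 : ℝ → ℝ) (N : Set ℝ) (t₀ : ℝ) (p : ℕ) :
    Prop where
  measurable_x : ∀ i, Measurable (x i)
  measurable_y : ∀ i, Measurable (y i)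
  indep : iIndepFun (fun i ω => (x i ω, y i ω)) P
  identDistrib : ∀ i, IdentDistrib (fun ω => (x i ω, y i ω)) (fun ω => (x 0 ω, y 0 ω)) P P
  bounded_support : Bornology.IsBounded (P.map (x 0)).support
  measurable_f : Measurable f
  f_nonneg : ∀ t, 0 ≤ f t
  density : P.map (x 0) = volume.withDensity (fun t => ENNReal.ofReal (f t))
  continuousOn_f : ContinuousOn f (P.map (x 0)).support
  regression : ∀ᵐ t ∂(P.map (x 0)), g t = ∫ v, v ∂(condDistrib (y 0) (x 0) P t)
  isOpen_N : IsOpen N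
  mem_N : t₀ ∈ N
  f_pos : ∀ t ∈ N ∩ (P.map (x 0)).support, 0 < f t
  condVariance : ∀ᵐ t ∂(P.map (x 0)), t ∈ N →
    σ2 t = variance (fun v : ℝ => v) (condDistrib (y 0) (x 0) P t)
  σ2_pos : ∀ t ∈ N ∩ (P.map (x 0)).support, 0 < σ2 t
  continuousOn_σ2 : ContinuousOn σ2 (N ∩ (P.map (x 0)).support)
  fourth_moment : ∃ M : ℝ≥0, ∀ᵐ t ∂(P.map (x 0)), t ∈ N →
    ∫⁻ v, ENNReal.ofReal (v ^ 4) ∂(condDistrib (y 0) (x 0) P t) ≤ (M : ℝ≥0∞)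
  contDiffOn_g : ContDiffOn ℝ ((p + 1 : ℕ) : WithTop ℕ∞) g (N ∩ (P.map (x 0)).support)
  holder_g : ∃ C η : ℝ≥0, 0 < η ∧
    HolderOnWith C η (iteratedDerivWithin (p + 1) g (N ∩ (P.map (x 0)).support))
      (N ∩ (P.map (x 0)).support)

/-- The assumption on the kernel and the bandwidth. The kernel has support `(-1, 1)`, on which it is
symmetric, positive and Lipschitz continuous; `h_n + (n h_n)⁻¹ log n → 0` and
`n h_n^(2p+3) → κ ∈ [0, ∞)`. -/
structure KernelBandwidthAssumption (K : ℝ → ℝ) (h : ℕ → ℝ) (κ : ℝ) (p : ℕ) : Prop where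
  K_zero : ∀ u, u ∉ Ioo (-1 : ℝ) 1 → K u = 0
  K_pos : ∀ u ∈ Ioo (-1 : ℝ) 1, 0 < K u
  K_symm : ∀ u, K (-u) = K u
  K_lipschitz : ∃ L : ℝ≥0, LipschitzOnWith L K (Ioo (-1 : ℝ) 1)
  h_pos : ∀ n, 0 < h n
  h_lim : Tendsto (fun n : ℕ => h n + ((n : ℝ) * h n)⁻¹ * Real.log n) atTop (𝓝 0)
  κ_nonneg : 0 ≤ κ
  κ_lim : Tendsto (fun n : ℕ => (n : ℝ) * h n ^ (2 * p + 3)) atTop (𝓝 κ)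

end LocPoly

end

open LocPoly

noncomputable section

namespace LocPoly

/-! In the coordinate u = (x - t₀)/h, the sample near t₀ looks like one with constant density c =
f(t₀) on a cone A (the line, or the half-line `Ici 0`), with constant conditional mean and variance.
Gram matrices, weights, leverages, the fit, C_n and Q_n are all built from empirical means (nh)⁻¹ ∑
φ(uᵢ) yᵢ^m with m ≤ 2. Such a mean tends in probability to f(t₀) E[y^m | x = t₀] ∫_A φ: Chebyshev's
inequality handles the fluctuation, dominated convergence the mean (`tendsto_probFilter_average`,
`tendsto_local_mean`).

Convergence in probability is convergence along the filter `probFilter` on ℕ × Ω. After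
`localLimits` the argument is therefore a deterministic one about limits along a filter, and
continuous operations such as matrix inversion pass to the limit directly.

The weights w_i(x_j) and C_n(x_j) are evaluated at random points, so their limits must be uniform in
the evaluation point. The kernel may jump at ±1, but its translates by amounts at most δ differ by
at most a step function of integral O(δ) (`exists_modulus`). This gives convergence jointly in the
index and the point (`tendsto_translate`), hence uniform convergence on compact sets. The weight
functions then converge uniformly on A to c⁻¹ (w - q(w_conv - w)), the fit converges locally
uniformly to g(t₀), and the leverages vanish like (nh)⁻¹. Expanding the squared residual leaves
three empirical means with uniformly convergent integrands, whose limits combine to σ²(t₀)/c times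
the squared L² norm of the limiting weight (`tendsto_variance`).

At an interior point the limits of C_n and C_{LP,n} coincide. They are nonzero by an orthogonal
polynomial argument that uses the parity of p (`integral_eqKernel_mul_pow_ne_zero`), so Q_n → 1 and
both estimators share a limit. The limiting variance is positive because w and w_conv both have
integral one over A: the limiting weight has integral one for every q and cannot vanish almost
everywhere. -/

/-- A bounded measurable function with bounded support. -/
structure IsTest (φ : ℝ → ℝ) : Prop where
  measurable : Measurable φ
  bdd : ∃ B, ∀ u, |φ u| ≤ B
  supp : ∃ R, ∀ u, R < |u| → φ u = 0

/-- A function that vanishes outside `(-1, 1)` and is Lipschitz continuous on `(-1, 1)`. -/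
structure IsKernelLike (ψ : ℝ → ℝ) : Prop where
  zero : ∀ u, u ∉ Ioo (-1 : ℝ) 1 → ψ u = 0
  lip : ∃ L : ℝ≥0, LipschitzOnWith L ψ (Ioo (-1 : ℝ) 1)

/-! ### Test functions and kernel-like functions -/

namespace IsTest

variable {φ ψ : ℝ → ℝ}

lemma add (hφ : IsTest φ) (hψ : IsTest ψ) : IsTest (fun u => φ u + ψ u) := by
  obtain ⟨B, hB⟩ := hφ.bdd
  obtain ⟨B', hB'⟩ := hψ.bdd
  obtain ⟨R, hR⟩ := hφ.supp
  obtain ⟨R', hR'⟩ := hψ.supp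
  refine ⟨hφ.measurable.add hψ.measurable, ⟨B + B', fun u => ?_⟩, ⟨max R R', fun u hu => ?_⟩⟩
  · exact (abs_add_le _ _).trans (add_le_add (hB u) (hB' u))
  · rw [hR u ((le_max_left _ _).trans_lt hu), hR' u ((le_max_right _ _).trans_lt hu), add_zero]

lemma mul_bdd (hφ : IsTest φ) (hm : Measurable ψ) (hb : ∃ B, ∀ u, |ψ u| ≤ B) :
    IsTest (fun u => φ u * ψ u) := by
  obtain ⟨B, hB⟩ := hφ.bdd
  obtain ⟨B', hB'⟩ := hb
  obtain ⟨R, hR⟩ := hφ.supp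
  refine ⟨hφ.measurable.mul hm, ⟨B * B', fun u => ?_⟩, ⟨R, fun u hu => by rw [hR u hu, zero_mul]⟩⟩
  rw [abs_mul]
  exact mul_le_mul (hB u) (hB' u) (abs_nonneg _) ((abs_nonneg _).trans (hB u))

lemma mul (hφ : IsTest φ) (hψ : IsTest ψ) : IsTest (fun u => φ u * ψ u) :=
  hφ.mul_bdd hψ.measurable hψ.bdd

lemma const_mul (hφ : IsTest φ) (a : ℝ) : IsTest (fun u => a * φ u) := by
  simpa only [mul_comm] using hφ.mul_bdd (ψ := fun _ => a) measurable_const ⟨|a|, fun _ => le_rfl⟩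

lemma neg (hφ : IsTest φ) : IsTest (fun u => - φ u) := by
  simpa using hφ.const_mul (-1)

lemma sub (hφ : IsTest φ) (hψ : IsTest ψ) : IsTest (fun u => φ u - ψ u) := by
  simpa only [sub_eq_add_neg] using hφ.add hψ.neg

lemma sum {κ : Type*} (s : Finset κ) {φ : κ → ℝ → ℝ} (hφ : ∀ k ∈ s, IsTest (φ k)) :
    IsTest (fun u => ∑ k ∈ s, φ k u) := by
  classical
  induction s using Finset.induction_on with
  | empty => simpa using (⟨measurable_const, ⟨0, by simp⟩, ⟨0, by simp⟩⟩ : IsTest fun _ => 0)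
  | insert a s ha ih =>
    simp only [Finset.sum_insert ha]
    exact (hφ a (by simp)).add (ih fun k hk => hφ k (by simp [hk]))

lemma indicator (hφ : IsTest φ) {A : Set ℝ} (hA : MeasurableSet A) : IsTest (A.indicator φ) := by
  obtain ⟨B, hB⟩ := hφ.bdd
  obtain ⟨R, hR⟩ := hφ.supp
  refine ⟨hφ.measurable.indicator hA, ⟨B, fun u => ?_⟩, ⟨R, fun u hu => ?_⟩⟩
  · by_cases h : u ∈ A
    · simpa [h] using hB u
    · simpa [h] using (abs_nonneg _).trans (hB u)
  · by_cases h : u ∈ A <;> simp [h, hR u hu]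

lemma comp_sub_left (hφ : IsTest φ) (s : ℝ) : IsTest (fun u => φ (s - u)) := by
  obtain ⟨B, hB⟩ := hφ.bdd
  obtain ⟨R, hR⟩ := hφ.supp
  refine ⟨hφ.measurable.comp (by fun_prop), ⟨B, fun u => hB _⟩, ⟨R + |s|, fun u hu => hR _ ?_⟩⟩
  have := abs_sub_abs_le_abs_sub u s
  rw [abs_sub_comm]
  linarith

lemma of_indicator_Icc (a b : ℝ) : IsTest ((Icc a b).indicator fun _ => (1 : ℝ)) := by
  refine ⟨measurable_const.indicator measurableSet_Icc, ⟨1, fun u => ?_⟩,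
    ⟨max |a| |b|, fun u hu => ?_⟩⟩
  · by_cases h : u ∈ Icc a b <;> simp [h]
  · refine indicator_of_notMem (fun h => ?_) _
    exact absurd (abs_le_max_abs_abs h.1 h.2) (not_le.2 hu)

lemma integrable (hφ : IsTest φ) : Integrable φ := by
  obtain ⟨B, hB⟩ := hφ.bdd
  obtain ⟨R, hR⟩ := hφ.supp
  have h1 : IntegrableOn φ (Icc (-R) R) :=
    Measure.integrableOn_of_bounded (M := B) (by simp) hφ.measurable.aestronglyMeasurable
      (Eventually.of_forall hB)
  refine (integrableOn_iff_integrable_of_support_subset fun u hu => ?_).1 h1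
  by_contra hn
  exact hu (hR u (not_le.1 fun h => hn (abs_le.1 h)))

end IsTest

namespace IsKernelLike

variable {ψ : ℝ → ℝ}

lemma bdd (hψ : IsKernelLike ψ) : ∃ B, ∀ u, |ψ u| ≤ B := by
  obtain ⟨L, hL⟩ := hψ.lip
  refine ⟨|ψ 0| + L, fun u => ?_⟩
  by_cases hu : u ∈ Ioo (-1 : ℝ) 1
  · have h1 := hL.dist_le_mul u hu 0 (by simp)
    rw [Real.dist_eq, Real.dist_eq, sub_zero] at h1
    have h2 : |u| ≤ 1 := abs_le.2 ⟨hu.1.le, hu.2.le⟩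
    have h3 := abs_sub_abs_le_abs_sub (ψ u) (ψ 0)
    have h4 : (L : ℝ) * |u| ≤ L := mul_le_of_le_one_right L.2 h2
    linarith
  · rw [hψ.zero u hu, abs_zero]; positivity

lemma measurable (hψ : IsKernelLike ψ) : Measurable ψ := by
  classical
  obtain ⟨L, hL⟩ := hψ.lip
  have h := ContinuousOn.measurable_piecewise (g := fun _ => (0 : ℝ)) hL.continuousOn
    continuousOn_const measurableSet_Ioo
  convert h using 1
  funext u
  by_cases hu : u ∈ Ioo (-1 : ℝ) 1
  · rw [piecewise_eq_of_mem _ _ _ hu]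
  · rw [piecewise_eq_of_notMem _ _ _ hu, hψ.zero u hu]

lemma zero_of_one_le (hψ : IsKernelLike ψ) {u : ℝ} (hu : 1 ≤ |u|) : ψ u = 0 :=
  hψ.zero u fun h => absurd (abs_lt.2 h) (not_lt.2 hu)

lemma isTest (hψ : IsKernelLike ψ) : IsTest ψ :=
  ⟨hψ.measurable, hψ.bdd, 1, fun _ hu => hψ.zero_of_one_le hu.le⟩

lemma id_mul (hψ : IsKernelLike ψ) : IsKernelLike (fun u => u * ψ u) := by
  obtain ⟨L, hL⟩ := hψ.lip
  obtain ⟨B, hB⟩ := hψ.bdd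
  refine ⟨fun u hu => by rw [hψ.zero u hu, mul_zero], L + B.toNNReal,
    LipschitzOnWith.of_dist_le_mul fun u hu v hv => ?_⟩
  have h1 := hL.dist_le_mul u hu v hv
  rw [Real.dist_eq, Real.dist_eq] at h1 ⊢
  have hB0 : 0 ≤ B := (abs_nonneg _).trans (hB 0)
  have h2 : |u| ≤ 1 := abs_le.2 ⟨hu.1.le, hu.2.le⟩
  rw [NNReal.coe_add, Real.coe_toNNReal _ hB0]
  calc |u * ψ u - v * ψ v| = |u * (ψ u - ψ v) + (u - v) * ψ v| := by ring_nf
    _ ≤ |u| * |ψ u - ψ v| + |u - v| * |ψ v| := by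
      rw [← abs_mul, ← abs_mul]; exact abs_add_le _ _
    _ ≤ 1 * (L * |u - v|) + |u - v| * B := by
      gcongr
      exact hB v
    _ = (L + B) * |u - v| := by ring

lemma pow_mul (hψ : IsKernelLike ψ) (m : ℕ) : IsKernelLike (fun u => u ^ m * ψ u) := by
  induction m with
  | zero => simpa using hψ
  | succ m ih =>
    have := ih.id_mul
    simpa only [pow_succ', mul_assoc] using this

lemma comp_neg (hψ : IsKernelLike ψ) : IsKernelLike (fun u => ψ (-u)) := by
  obtain ⟨L, hL⟩ := hψ.lip
  have hm : ∀ u : ℝ, -u ∈ Ioo (-1 : ℝ) 1 ↔ u ∈ Ioo (-1 : ℝ) 1 := fun u =>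
    ⟨fun h => ⟨by linarith [h.2], by linarith [h.1]⟩, fun h => ⟨by linarith [h.2], by linarith [h.1]⟩⟩
  refine ⟨fun u hu => hψ.zero _ fun h => hu ((hm u).1 h), L,
    LipschitzOnWith.of_dist_le_mul fun u hu v hv => ?_⟩
  have := hL.dist_le_mul _ ((hm u).2 hu) _ ((hm v).2 hv)
  rwa [dist_neg_neg] at this

end IsKernelLike

/-! ### Moment matrices of a kernel -/

section Moments

variable {K : ℝ → ℝ} {B : Set ℝ}

lemma integrable_polynomial_mul (hK : IsKernelLike K) (P : Polynomial ℝ) :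
    Integrable (fun u => P.eval u * K u) := by
  induction P using Polynomial.induction_on' with
  | add P Q hP hQ =>
    exact (hP.add hQ).congr (Eventually.of_forall fun u => by
      simp only [Pi.add_apply, Polynomial.eval_add, add_mul])
  | monomial n a =>
    simpa only [Polynomial.eval_monomial, mul_assoc] using
      ((hK.pow_mul n).isTest.integrable.const_mul a)

/-- The integrand is nonnegative and K is positive on (0, 1), so P vanishes at almost every point of
(0, 1). If P were nonzero, that interval would lie, up to a null set, in its finite root set. -/
lemma polynomial_eq_zero_of_setIntegral_sq (hK : IsKernelLike K)
    (hpos : ∀ u ∈ Ioo (-1 : ℝ) 1, 0 < K u) (hB : MeasurableSet B) (hsub : Ioo (0 : ℝ) 1 ⊆ B)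
    {P : Polynomial ℝ} (h0 : ∫ u in B, P.eval u ^ 2 * K u = 0) : P = 0 := by
  have hnn : ∀ u, 0 ≤ P.eval u ^ 2 * K u := fun u => by
    by_cases hu : u ∈ Ioo (-1 : ℝ) 1
    · exact mul_nonneg (sq_nonneg _) (hpos u hu).le
    · rw [hK.zero u hu, mul_zero]
  have hint : IntegrableOn (fun u => P.eval u ^ 2 * K u) B := by
    exact ((integrable_polynomial_mul hK (P ^ 2)).congr (Eventually.of_forall fun u => by
      simp only [Polynomial.eval_pow])).integrableOn
  rw [setIntegral_eq_zero_iff_of_nonneg_ae (Eventually.of_forall hnn) hint] at h0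
  by_contra hP
  have hroots : volume ((P.roots.toFinset : Finset ℝ) : Set ℝ) = 0 :=
    (Finset.finite_toSet _).measure_zero _
  have h1 : ∀ᵐ u, u ∉ Ioo (0 : ℝ) 1 := by
    have h2 := (ae_restrict_iff' hB).1 h0
    filter_upwards [h2, measure_eq_zero_iff_ae_notMem.1 hroots] with u hu hr hmem
    have h3 := hu (hsub hmem)
    have h4 := (hpos u ⟨by linarith [hmem.1], hmem.2⟩).ne'
    apply hr
    simpa [hP, h4] using h3
  have := measure_eq_zero_iff_ae_notMem.2 h1
  simp at this

lemma setIntegral_sum_pow_mul (hK : IsKernelLike K) {n : ℕ} (a : Fin n → ℝ) (e : Fin n → ℕ) :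
    ∫ u in B, (∑ k, a k * u ^ e k) * K u = ∑ k, a k * ∫ u in B, u ^ e k * K u := by
  simp only [Finset.sum_mul, mul_assoc]
  rw [integral_finsetSum]
  · simp only [integral_const_mul]
  · intro k _
    exact ((hK.pow_mul _).isTest.integrable.const_mul _).integrableOn

/-- A null vector v of the matrix is the coefficient vector of a polynomial P with ∫_B P² K = v'Mv =
0. Requiring only (0, 1) ⊆ B covers the whole line and every domain truncated on the left at -s with
s ≥ 0. -/
lemma kernelMoment_det_ne_zero (hK : IsKernelLike K)
    (hpos : ∀ u ∈ Ioo (-1 : ℝ) 1, 0 < K u) (hB : MeasurableSet B) (hsub : Ioo (0 : ℝ) 1 ⊆ B)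
    (q : ℕ) : (kernelMoment K q B).det ≠ 0 := by
  intro hdet
  obtain ⟨v, hv, hMv⟩ := Matrix.exists_mulVec_eq_zero_iff.2 hdet
  let P : Polynomial ℝ := ∑ k : Fin (q + 1), Polynomial.C (v k) * Polynomial.X ^ (k : ℕ)
  have hev : ∀ u, P.eval u = ∑ k : Fin (q + 1), v k * u ^ (k : ℕ) := fun u => by
    simp [P, Polynomial.eval_finsetSum]
  have hP : P = 0 := by
    apply polynomial_eq_zero_of_setIntegral_sq hK hpos hB hsub
    have h1 : ∀ j : Fin (q + 1), ∫ u in B, (∑ k : Fin (q + 1), v k * u ^ ((j : ℕ) + k)) * K u = 0 := by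
      intro j
      rw [setIntegral_sum_pow_mul hK v (fun k => (j : ℕ) + k)]
      have := congrFun hMv j
      simp only [Matrix.mulVec, dotProduct, kernelMoment, Matrix.of_apply, Pi.zero_apply] at this
      simpa only [mul_comm] using this
    calc ∫ u in B, P.eval u ^ 2 * K u
        = ∫ u in B, ∑ j : Fin (q + 1), v j * ((∑ k : Fin (q + 1), v k * u ^ ((j : ℕ) + k)) * K u) := by
          congr 1; funext u
          rw [hev, sq, Finset.sum_mul, Finset.sum_mul]
          refine Finset.sum_congr rfl fun j _ => ?_
          simp only [pow_add, ← mul_assoc, Finset.mul_sum, Finset.sum_mul]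
          refine Finset.sum_congr rfl fun k _ => ?_
          ring
      _ = ∑ j : Fin (q + 1), v j * ∫ u in B, (∑ k : Fin (q + 1), v k * u ^ ((j : ℕ) + k)) * K u := by
          rw [integral_finsetSum]
          · simp only [integral_const_mul]
          · intro j _
            refine Integrable.const_mul ?_ _
            simp only [Finset.sum_mul, mul_assoc]
            exact (integrable_finsetSum _ fun k _ =>
              ((hK.pow_mul _).isTest.integrable.const_mul _)).integrableOn
      _ = 0 := by simp [h1]
  apply hv
  funext k
  have : P.coeff k = v k := by
    simp only [P, Polynomial.finsetSum_coeff, Polynomial.coeff_C_mul, Polynomial.coeff_X_pow]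
    rw [Finset.sum_eq_single k]
    · simp
    · intro j _ hj
      have : (k : ℕ) ≠ j := fun h => hj (Fin.ext h.symm)
      simp [this]
    · simp
  simpa [hP] using this.symm

/-- The `k`-th coefficient of the equivalent kernel. -/
def eqCoeff (K : ℝ → ℝ) (p : ℕ) (B : Set ℝ) (k : Fin (p + 1)) : ℝ := (kernelMoment K p B)⁻¹ 0 k

lemma eqKernel_eq_sum (p : ℕ) (u : ℝ) :
    eqKernel K p B u = ∑ k : Fin (p + 1), eqCoeff K p B k * (u ^ (k : ℕ) * K u) := by
  simp only [eqKernel, Matrix.mulVec, dotProduct, rVec, Finset.sum_mul, eqCoeff, mul_assoc]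

lemma setIntegral_eqKernel_mul_pow (hK : IsKernelLike K) (p m : ℕ) :
    ∫ u in B, eqKernel K p B u * u ^ m
      = ∑ k : Fin (p + 1), eqCoeff K p B k * ∫ u in B, u ^ ((k : ℕ) + m) * K u := by
  rw [← setIntegral_sum_pow_mul hK _ (fun k : Fin (p + 1) => (k : ℕ) + m)]
  congr 1; funext u
  rw [eqKernel_eq_sum, Finset.sum_mul, Finset.sum_mul]
  refine Finset.sum_congr rfl fun k _ => ?_
  ring

/-- This is the (0, 0) entry of M⁻¹M = 1: integrating r_p K gives the zeroth column of M. -/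
lemma setIntegral_eqKernel (hK : IsKernelLike K)
    (hpos : ∀ u ∈ Ioo (-1 : ℝ) 1, 0 < K u) (hB : MeasurableSet B) (hsub : Ioo (0 : ℝ) 1 ⊆ B)
    (p : ℕ) : ∫ u in B, eqKernel K p B u = 1 := by
  have h1 := setIntegral_eqKernel_mul_pow (B := B) hK p 0
  simp only [pow_zero, mul_one] at h1
  rw [h1]
  have h2 := Matrix.nonsing_inv_mul (kernelMoment K p B)
    (isUnit_iff_ne_zero.2 (kernelMoment_det_ne_zero hK hpos hB hsub p))
  have h3 := congrFun (congrFun h2 0) 0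
  simpa [Matrix.mul_apply, kernelMoment, eqCoeff] using h3

lemma integral_polynomial_mul_eq_zero (hK : IsKernelLike K) {n : ℕ} {P Q : Polynomial ℝ}
    (hQ : Q.natDegree ≤ n) (hP : ∀ j ≤ n, ∫ u, (u ^ j * P.eval u) * K u = 0) :
    ∫ u, (Q * P).eval u * K u = 0 := by
  have h1 : ∀ u, (Q * P).eval u * K u
      = ∑ j ∈ Finset.range (n + 1), Q.coeff j * ((u ^ j * P.eval u) * K u) := fun u => by
    rw [Polynomial.eval_mul, Polynomial.eval_eq_sum_range' (Nat.lt_succ_of_le hQ),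
      Finset.sum_mul, Finset.sum_mul]
    exact Finset.sum_congr rfl fun j _ => by ring
  simp only [h1]
  rw [integral_finsetSum]
  · refine Finset.sum_eq_zero fun j hj => ?_
    rw [integral_const_mul, hP j (Nat.lt_succ_iff.1 (Finset.mem_range.1 hj)), mul_zero]
  · intro j _
    refine Integrable.const_mul ?_ _
    exact (integrable_polynomial_mul hK (Polynomial.X ^ j * P)).congr (Eventually.of_forall fun u => by
      simp only [Polynomial.eval_mul, Polynomial.eval_pow, Polynomial.eval_X])

lemma integral_odd_pow_mul (hsymm : ∀ u, K (-u) = K u) {m : ℕ} (hm : Odd m) :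
    ∫ u, u ^ m * K u = 0 := by
  have h1 := integral_neg_eq_self (fun u : ℝ => u ^ m * K u) volume
  simp only [hm.neg_pow, hsymm, neg_mul, integral_neg] at h1
  linarith

/-- For odd `p` and a symmetric kernel, the leading constant of the bias does not vanish. -/
lemma integral_eqKernel_mul_pow_ne_zero (hK : IsKernelLike K)
    (hpos : ∀ u ∈ Ioo (-1 : ℝ) 1, 0 < K u) (hsymm : ∀ u, K (-u) = K u) {p : ℕ} (hp : Odd p) :
    ∫ u, eqKernel K p univ u * u ^ (p + 1) ≠ 0 := by
  intro h0
  set M := kernelMoment K p univ with hMdef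
  have hMapp : ∀ i j, M i j = ∫ u, u ^ ((i : ℕ) + j) * K u := fun i j => by
    simp [hMdef, kernelMoment]
  have hdet : IsUnit M.det := isUnit_iff_ne_zero.2
    (kernelMoment_det_ne_zero hK hpos MeasurableSet.univ (subset_univ _) p)
  -- The vector d holds the coefficients of the projection of u^(p+1) onto polynomials of degree at
  -- most p in L²(K), and d 0 is the constant assumed to be zero.
  let μ : Fin (p + 1) → ℝ := fun j => ∫ u, u ^ ((j : ℕ) + (p + 1)) * K u
  let d := M⁻¹.mulVec μ
  have hMd : M.mulVec d = μ := by
    simp only [d, Matrix.mulVec_mulVec, Matrix.mul_nonsing_inv _ hdet, Matrix.one_mulVec]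
  have hd0 : d 0 = 0 := by
    have h1 := setIntegral_eqKernel_mul_pow (B := univ) hK p (p + 1)
    rw [setIntegral_univ] at h1
    simp only [setIntegral_univ, h0] at h1
    simpa [d, Matrix.mulVec, dotProduct, μ, eqCoeff] using h1.symm
  have hpe : Even (p + 1) := hp.add_one
  have hodd : ∀ k : Fin (p + 1), Odd (k : ℕ) → d k = 0 := by
    -- Reflection u ↦ -u: moments of odd order vanish and p + 1 is even, so flipping the signs of
    -- the odd coefficients gives another solution of the normal equations. Uniqueness then kills
    -- the odd coefficients.
    let d' : Fin (p + 1) → ℝ := fun k => (-1) ^ (k : ℕ) * d k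
    have hMd' : M.mulVec d' = μ := by
      funext j
      have hj := congrFun hMd j
      simp only [Matrix.mulVec, dotProduct] at hj ⊢
      have h1 : ∀ k, M j k * d' k = (-1) ^ (j : ℕ) * (M j k * d k) := fun k => by
        rcases Nat.even_or_odd ((j : ℕ) + k) with he | ho
        · have : ((-1 : ℝ)) ^ (k : ℕ) = (-1) ^ (j : ℕ) := by
            rcases Nat.even_or_odd (j : ℕ) with hj | hj
            · have hk : Even (k : ℕ) := (Nat.even_add.1 he).1 hj
              rw [hj.neg_one_pow, hk.neg_one_pow]
            · have hk : Odd (k : ℕ) := by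
                rw [← Nat.not_even_iff_odd] at hj ⊢
                exact fun h => hj ((Nat.even_add.1 he).2 h)
              rw [hj.neg_one_pow, hk.neg_one_pow]
          simp only [d', this]; ring
        · simp [hMapp, integral_odd_pow_mul hsymm ho]
      simp only [h1]
      rw [← Finset.mul_sum, hj]
      rcases Nat.even_or_odd (j : ℕ) with hj | hj
      · rw [hj.neg_one_pow, one_mul]
      · have : μ j = 0 := integral_odd_pow_mul hsymm (hj.add_even hpe)
        rw [this, mul_zero]
    have hdd : d' = d := by
      have : M⁻¹.mulVec (M.mulVec d') = M⁻¹.mulVec (M.mulVec d) := by rw [hMd, hMd']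
      simpa only [Matrix.mulVec_mulVec, Matrix.nonsing_inv_mul _ hdet, Matrix.one_mulVec] using this
    intro k hk
    have := congrFun hdd k
    simp only [d', hk.neg_one_pow] at this
    linarith
  let S : Polynomial ℝ := ∑ k : Fin (p + 1), Polynomial.C (d k) * Polynomial.X ^ (k : ℕ)
  -- The residual of the projection: the monic polynomial of degree p + 1 that is K-orthogonal to
  -- all lower degrees.
  let q : Polynomial ℝ := Polynomial.X ^ (p + 1) - S
  have hSev : ∀ u, S.eval u = ∑ k : Fin (p + 1), d k * u ^ (k : ℕ) := fun u => by
    simp [S, Polynomial.eval_finsetSum]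
  have hScoeff : ∀ k : Fin (p + 1), S.coeff k = d k := fun k => by
    simp only [S, Polynomial.finsetSum_coeff, Polynomial.coeff_C_mul, Polynomial.coeff_X_pow]
    rw [Finset.sum_eq_single k]
    · simp
    · intro j _ hj
      have : (k : ℕ) ≠ j := fun h => hj (Fin.ext h.symm)
      simp [this]
    · simp
  have hSdeg : S.degree < (p + 1 : ℕ) := by
    refine (Polynomial.degree_sum_le _ _).trans_lt ?_
    rw [Finset.sup_lt_iff (by exact WithBot.bot_lt_coe _)]
    intro k _
    refine (Polynomial.degree_C_mul_X_pow_le _ _).trans_lt ?_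
    exact_mod_cast k.2
  have hqmonic : q.Monic := Polynomial.monic_X_pow_sub hSdeg
  have hqdeg : q.natDegree = p + 1 := by
    rw [Polynomial.natDegree_eq_of_degree_eq (Polynomial.degree_sub_eq_left_of_degree_lt
      (by rwa [Polynomial.degree_X_pow]))]
    exact Polynomial.natDegree_X_pow _
  have horth : ∀ j ≤ p, ∫ u, (u ^ j * q.eval u) * K u = 0 := by
    intro j hj
    have h1 := congrFun hMd ⟨j, Nat.lt_succ_of_le hj⟩
    simp only [Matrix.mulVec, dotProduct, hMapp, μ] at h1
    have h2 := setIntegral_sum_pow_mul (B := univ) hK d (fun k => j + (k : ℕ))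
    simp only [setIntegral_univ] at h2
    have h3 : ∀ u, (u ^ j * q.eval u) * K u
        = u ^ (j + (p + 1)) * K u - (∑ k : Fin (p + 1), d k * u ^ (j + (k : ℕ))) * K u := fun u => by
      have : u ^ j * ∑ k : Fin (p + 1), d k * u ^ (k : ℕ)
          = ∑ k : Fin (p + 1), d k * u ^ (j + (k : ℕ)) := by
        rw [Finset.mul_sum]
        exact Finset.sum_congr rfl fun k _ => by ring
      simp only [q, Polynomial.eval_sub, Polynomial.eval_pow, Polynomial.eval_X, hSev, ← this]
      ring
    simp only [h3]
    rw [integral_sub (hK.pow_mul _).isTest.integrable, h2, ← h1, sub_eq_zero]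
    · exact Finset.sum_congr rfl fun k _ => mul_comm _ _
    · simp only [Finset.sum_mul, mul_assoc]
      exact integrable_finsetSum _ fun k _ => ((hK.pow_mul _).isTest.integrable.const_mul _)
  have hp1 : 1 ≤ p := hp.pos
  -- Coefficient 0 of q vanishes by the assumption, coefficient 1 by parity; p ≥ 1 keeps the leading
  -- term out of both. With q = X² r, orthogonality of q to r reads ∫ (u r(u))² K(u) du = 0, which
  -- forces r = 0.
  have hdvd : Polynomial.X ^ 2 ∣ q := by
    rw [Polynomial.X_pow_dvd_iff]
    intro i hi
    have hc : q.coeff i = - d ⟨i, by omega⟩ := by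
      have := hScoeff ⟨i, by omega⟩
      simp only at this
      simp only [q, Polynomial.coeff_sub, Polynomial.coeff_X_pow, this]
      rw [if_neg (by omega), zero_sub]
    rw [hc]
    interval_cases i
    · simpa using hd0
    · rw [hodd _ (by simp), neg_zero]
  obtain ⟨r, hr⟩ := hdvd
  have hq0 : q ≠ 0 := hqmonic.ne_zero
  have hr0 : r ≠ 0 := fun h => hq0 (by rw [hr, h, mul_zero])
  have hrdeg : r.natDegree ≤ p := by
    have : q.natDegree = 2 + r.natDegree := by
      rw [hr, Polynomial.natDegree_mul (by simp) hr0, Polynomial.natDegree_X_pow]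
    omega
  have h4 := integral_polynomial_mul_eq_zero hK hrdeg horth
  have h5 : Polynomial.X * r = 0 := by
    apply polynomial_eq_zero_of_setIntegral_sq hK hpos MeasurableSet.univ (subset_univ _)
    rw [setIntegral_univ, ← h4]
    congr 1; funext u
    rw [hr]
    simp only [Polynomial.eval_mul, Polynomial.eval_X, Polynomial.eval_pow]
    ring
  exact hr0 ((mul_eq_zero.1 h5).resolve_left Polynomial.X_ne_zero)

end Moments

/-! ### Locally weighted empirical means -/

/-- The empirical mean `(nh)⁻¹ ∑ᵢ φ(zᵢ) bᵢ`. -/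
def empMean (n : ℕ) (h : ℝ) (z b : ℕ → ℝ) (φ : ℝ → ℝ) : ℝ :=
  (n * h)⁻¹ * ∑ i ∈ Finset.range n, φ (z i) * b i

section EmpMean

variable {n : ℕ} {h : ℝ} {z b d : ℕ → ℝ} {φ ψ : ℝ → ℝ}

lemma empMean_sub (φ ψ : ℝ → ℝ) :
    empMean n h z b (fun u => φ u - ψ u) = empMean n h z b φ - empMean n h z b ψ := by
  simp only [empMean, sub_mul, Finset.sum_sub_distrib, mul_sub]

lemma empMean_const_mul (a : ℝ) (φ : ℝ → ℝ) :
    empMean n h z b (fun u => a * φ u) = a * empMean n h z b φ := by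
  simp only [empMean, mul_assoc, ← Finset.mul_sum]
  ring

lemma abs_empMean_le (hh : 0 < h) (hbd : ∀ j, |b j| ≤ d j)
    (hφ : ∀ j < n, |φ (z j)| ≤ ψ (z j)) : |empMean n h z b φ| ≤ empMean n h z d ψ := by
  have h0 : 0 ≤ ((n : ℝ) * h)⁻¹ := by positivity
  rw [empMean, empMean, abs_mul, abs_of_nonneg h0]
  refine mul_le_mul_of_nonneg_left ((Finset.abs_sum_le_sum_abs _ _).trans
    (Finset.sum_le_sum fun j hj => ?_)) h0
  rw [abs_mul]
  have := hφ j (Finset.mem_range.1 hj)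
  exact mul_le_mul this (hbd j) (abs_nonneg _) ((abs_nonneg _).trans this)

end EmpMean

/-- The empirical means of test functions converge to multiples of Lebesgue integrals. -/
def EmpTendsto {ι : Type*} (l : Filter ι) (n : ι → ℕ) (h : ι → ℝ) (z b : ι → ℕ → ℝ) (A : Set ℝ)
    (c : ℝ) : Prop :=
  ∀ φ, IsTest φ → Tendsto (fun i => empMean (n i) (h i) (z i) (b i) φ) l (𝓝 (c * ∫ u in A, φ u))

/-! ### Uniform convergence and empirical means with varying integrands -/

section Uniform

variable {ι : Type*} {l : Filter ι} {n : ι → ℕ} {h : ι → ℝ} {z b d : ι → ℕ → ℝ} {A : Set ℝ}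
  {c c' : ℝ}

/-- Replacing F by its limit costs at most the uniform distance on A times the empirical mean of the
weights d over [-R, R], and that mean stays bounded because it converges. The majorant d is needed
because b may change sign. -/
lemma EmpTendsto.tendsto_of_tendstoUniformlyOn (hb : EmpTendsto l n h z b A c)
    (hd : EmpTendsto l n h z d A c') (hbd : ∀ i j, |b i j| ≤ d i j) (hh : ∀ i, 0 < h i)
    (hz : ∀ R, ∀ᶠ i in l, ∀ j < n i, |z i j| ≤ R → z i j ∈ A) {F : ι → ℝ → ℝ} {G : ℝ → ℝ} {R : ℝ}
    (hF : ∀ i u, R < |u| → F i u = 0) (hG : IsTest G) (hGR : ∀ u, R < |u| → G u = 0)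
    (hu : TendstoUniformlyOn F G l A) :
    Tendsto (fun i => empMean (n i) (h i) (z i) (b i) (F i)) l (𝓝 (c * ∫ u in A, G u)) := by
  set I : ℝ → ℝ := (Icc (-R) R).indicator fun _ => 1 with hI
  have hIt : IsTest I := IsTest.of_indicator_Icc _ _
  have h1 := hd I hIt
  set D := c' * ∫ u in A, I u
  have h2 : Tendsto (fun i => empMean (n i) (h i) (z i) (b i) (fun u => F i u - G u)) l (𝓝 0) := by
    rw [Metric.tendsto_nhds]
    intro ε hε
    have hev : ∀ᶠ i in l, empMean (n i) (h i) (z i) (d i) I < |D| + 1 :=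
      h1.eventually (gt_mem_nhds (lt_of_le_of_lt (le_abs_self D) (lt_add_one _)))
    have hpos : 0 < |D| + 1 := by positivity
    filter_upwards [hev, hz R, Metric.tendstoUniformlyOn_iff.1 hu (ε / (|D| + 1)) (by positivity)]
      with i hi hzi hui
    rw [Real.dist_eq, sub_zero]
    calc |empMean (n i) (h i) (z i) (b i) (fun u => F i u - G u)|
        ≤ empMean (n i) (h i) (z i) (d i) (fun u => ε / (|D| + 1) * I u) := by
          refine abs_empMean_le (hh i) (hbd i) fun j hj => ?_
          by_cases hR : |z i j| ≤ R
          · have hm : z i j ∈ Icc (-R) R := abs_le.1 hR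
            have := hui _ (hzi j hj hR)
            rw [dist_comm, Real.dist_eq] at this
            simpa [hI, hm] using this.le
          · have hm : z i j ∉ Icc (-R) R := fun h => hR (abs_le.2 h)
            simp [hI, hm, hF i _ (not_le.1 hR), hGR _ (not_le.1 hR)]
      _ = ε / (|D| + 1) * empMean (n i) (h i) (z i) (d i) I := empMean_const_mul _ _
      _ < ε / (|D| + 1) * (|D| + 1) := by gcongr
      _ = ε := by field_simp
  have h3 := h2.add (hb G hG)
  simp only [empMean_sub, sub_add_cancel, zero_add] at h3
  exact h3

/-- Convergence jointly in the index and the point is local uniform convergence to a continuous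
limit; compactness makes it global. -/
lemma tendstoUniformlyOn_of_forall_tendsto {F : ι → ℝ → ℝ} {f : ℝ → ℝ} {S : Set ℝ}
    (hS : IsCompact S) (hf : ContinuousOn f S)
    (hF : ∀ x ∈ S, Tendsto (fun q : ι × ℝ => F q.1 q.2) (l ×ˢ 𝓝[S] x) (𝓝 (f x))) :
    TendstoUniformlyOn F f l S := by
  rw [← tendstoLocallyUniformlyOn_iff_tendstoUniformlyOn_of_compact hS,
    tendstoLocallyUniformlyOn_iff_forall_tendsto]
  intro x hx
  have h1 : Tendsto (fun q : ι × ℝ => f q.2) (l ×ˢ 𝓝[S] x) (𝓝 (f x)) :=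
    (hf x hx).tendsto.comp tendsto_snd
  exact (h1.prodMk_nhds (hF x hx)).mono_right (nhds_le_uniformity _)

lemma tendstoUniformlyOn_of_inter_Icc {F : ι → ℝ → ℝ} {f : ℝ → ℝ} {S : Set ℝ} {R : ℝ}
    (hu : TendstoUniformlyOn F f l (S ∩ Icc (-R) R)) (hF : ∀ i u, R < |u| → F i u = 0)
    (hf : ∀ u, R < |u| → f u = 0) : TendstoUniformlyOn F f l S := by
  rw [Metric.tendstoUniformlyOn_iff] at hu ⊢
  intro ε hε
  filter_upwards [hu ε hε] with i hi u hus
  by_cases hR : |u| ≤ R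
  · exact hi u ⟨hus, abs_le.1 hR⟩
  · rw [hF i u (not_le.1 hR), hf u (not_le.1 hR), dist_self]; exact hε

lemma tendstoUniformlyOn_mul_of_bdd {F G : ι → ℝ → ℝ} {f g : ℝ → ℝ} {S : Set ℝ}
    (hF : TendstoUniformlyOn F f l S) (hG : TendstoUniformlyOn G g l S)
    (hf : ∃ B, ∀ u ∈ S, |f u| ≤ B) (hg : ∃ B, ∀ u ∈ S, |g u| ≤ B) :
    TendstoUniformlyOn (fun i u => F i u * G i u) (fun u => f u * g u) l S := by
  obtain ⟨B, hB⟩ := hf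
  obtain ⟨C, hC⟩ := hg
  rw [Metric.tendstoUniformlyOn_iff] at hF hG ⊢
  intro ε hε
  set M := |B| + |C| + 1 with hM
  have hMpos : 0 < M := by positivity
  set e := min 1 (ε / (2 * M)) with he
  have hepos : 0 < e := by positivity
  filter_upwards [hF e hepos, hG e hepos] with i h1 h2 u hu
  have h1 := h1 u hu
  have h2 := h2 u hu
  rw [Real.dist_eq] at h1 h2 ⊢
  have e1 : e ≤ 1 := min_le_left _ _
  have e2 : e * (2 * M) ≤ ε := by
    calc e * (2 * M) ≤ ε / (2 * M) * (2 * M) := by gcongr; exact min_le_right _ _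
      _ = ε := by field_simp
  have hG' : |G i u| ≤ |C| + 1 := by
    have := abs_sub_abs_le_abs_sub (G i u) (g u)
    rw [abs_sub_comm] at this
    have := (hC u hu).trans (le_abs_self C)
    linarith
  calc |f u * g u - F i u * G i u| = |f u * (g u - G i u) + (f u - F i u) * G i u| := by ring_nf
    _ ≤ |f u| * |g u - G i u| + |f u - F i u| * |G i u| := by
      rw [← abs_mul, ← abs_mul]; exact abs_add_le _ _
    _ ≤ |B| * e + e * (|C| + 1) :=
      add_le_add (mul_le_mul ((hB u hu).trans (le_abs_self B)) h2.le (abs_nonneg _) (abs_nonneg _))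
        (mul_le_mul h1.le hG' (abs_nonneg _) hepos.le)
    _ = e * M := by rw [hM]; ring
    _ < e * (2 * M) := by nlinarith
    _ ≤ ε := e2

lemma tendstoUniformlyOn_sum {κ : Type*} (s : Finset κ) {F : κ → ι → ℝ → ℝ} {f : κ → ℝ → ℝ}
    {S : Set ℝ} (hF : ∀ k ∈ s, TendstoUniformlyOn (F k) (f k) l S) :
    TendstoUniformlyOn (fun i u => ∑ k ∈ s, F k i u) (fun u => ∑ k ∈ s, f k u) l S := by
  classical
  induction s using Finset.induction_on with
  | empty =>
    rw [Metric.tendstoUniformlyOn_iff]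
    exact fun ε hε => Eventually.of_forall fun i u _ => by simpa using hε
  | insert a s ha ih =>
    simp only [Finset.sum_insert ha]
    exact (hF a (by simp)).add (ih fun k hk => hF k (by simp [hk]))

lemma tendstoUniformlyOn_of_tendsto {a : ι → ℝ} {a₀ : ℝ} (ha : Tendsto a l (𝓝 a₀)) (S : Set ℝ) :
    TendstoUniformlyOn (fun i _ => a i) (fun _ => a₀) l S := by
  rw [Metric.tendstoUniformlyOn_iff]
  intro ε hε
  filter_upwards [Metric.tendsto_nhds.1 ha ε hε] with i hi u _
  rwa [dist_comm]

end Uniform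

/-! ### Translates of a kernel -/

/-- A bound for the modulus of continuity of `u ↦ ψ (u - s)` at `u₀`. -/
def modulus (L B δ u₀ s : ℝ) : ℝ :=
  L * δ * (Icc (u₀ - 2) (u₀ + 2)).indicator (fun _ => 1) s +
    (B * (Icc (u₀ - 1 - δ) (u₀ - 1 + δ)).indicator (fun _ => 1) s +
      B * (Icc (u₀ + 1 - δ) (u₀ + 1 + δ)).indicator (fun _ => 1) s)

lemma isTest_modulus (L B δ u₀ : ℝ) : IsTest (modulus L B δ u₀) :=
  ((IsTest.of_indicator_Icc _ _).const_mul _).add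
    (((IsTest.of_indicator_Icc _ _).const_mul _).add ((IsTest.of_indicator_Icc _ _).const_mul _))

lemma modulus_nonneg {L B δ : ℝ} (hL : 0 ≤ L) (hB : 0 ≤ B) (hδ : 0 ≤ δ) (u₀ s : ℝ) :
    0 ≤ modulus L B δ u₀ s := by
  have h : ∀ a b : ℝ, 0 ≤ (Icc a b).indicator (fun _ => (1 : ℝ)) s := fun a b =>
    indicator_nonneg (fun _ _ => zero_le_one) _
  have := h (u₀ - 2) (u₀ + 2)
  have := h (u₀ - 1 - δ) (u₀ - 1 + δ)
  have := h (u₀ + 1 - δ) (u₀ + 1 + δ)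
  unfold modulus
  positivity

lemma integral_modulus (L B u₀ : ℝ) {δ : ℝ} (hδ : 0 ≤ δ) :
    ∫ s, modulus L B δ u₀ s = (4 * L + 4 * B) * δ := by
  have h : ∀ a b : ℝ, a ≤ b → ∫ s, (Icc a b).indicator (fun _ => (1 : ℝ)) s = b - a := by
    intro a b hab
    rw [integral_indicator measurableSet_Icc]
    simp [hab]
  have hi : ∀ r a b : ℝ, Integrable fun s => r * (Icc a b).indicator (fun _ => (1 : ℝ)) s :=
    fun r a b => ((IsTest.of_indicator_Icc a b).const_mul r).integrable
  have h1 := integral_add (hi (L * δ) (u₀ - 2) (u₀ + 2))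
    ((hi B (u₀ - 1 - δ) (u₀ - 1 + δ)).add (hi B (u₀ + 1 - δ) (u₀ + 1 + δ)))
  simp only [Pi.add_apply] at h1
  unfold modulus
  rw [h1, integral_add (hi _ _ _) (hi _ _ _)]
  simp only [integral_const_mul]
  rw [h _ _ (by linarith), h _ _ (by linarith), h _ _ (by linarith)]
  ring

lemma setIntegral_modulus_le {L B δ : ℝ} (hL : 0 ≤ L) (hB : 0 ≤ B) (hδ : 0 ≤ δ) (u₀ : ℝ)
    (A : Set ℝ) : ∫ s in A, modulus L B δ u₀ s ≤ (4 * L + 4 * B) * δ := by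
  rw [← integral_modulus L B u₀ hδ]
  exact setIntegral_le_integral (isTest_modulus L B δ u₀).integrable
    (Eventually.of_forall fun s => modulus_nonneg hL hB hδ u₀ s)

/-- If both arguments lie in (-1, 1), the Lipschitz bound applies. If exactly one does, s lies
within δ of an endpoint u₀ ± 1, where only the sup bound B is available. A jump of ψ at ±1 therefore
costs only intervals of length 2δ. -/
lemma IsKernelLike.exists_modulus {ψ : ℝ → ℝ} (hψ : IsKernelLike ψ) :
    ∃ L B : ℝ, 0 ≤ L ∧ 0 ≤ B ∧ (∀ u, |ψ u| ≤ B) ∧ ∀ δ u₀ u s : ℝ, 0 ≤ δ → |u - u₀| ≤ δ →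
      |ψ (u - s) - ψ (u₀ - s)| ≤ modulus L B δ u₀ s := by
  obtain ⟨L, hL⟩ := hψ.lip
  obtain ⟨B, hB⟩ := hψ.bdd
  have hB0 : 0 ≤ B := (abs_nonneg _).trans (hB 0)
  refine ⟨L, B, L.2, hB0, hB, fun δ u₀ u s hδ hu => ?_⟩
  have hind : ∀ a b : ℝ, 0 ≤ (Icc a b).indicator (fun _ => (1 : ℝ)) s := fun a b =>
    indicator_nonneg (fun _ _ => zero_le_one) _
  have i1 := hind (u₀ - 2) (u₀ + 2)
  have i2 := hind (u₀ - 1 - δ) (u₀ - 1 + δ)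
  have i3 := hind (u₀ + 1 - δ) (u₀ + 1 + δ)
  have hL0 : (0 : ℝ) ≤ L := L.2
  have hud := abs_le.1 hu
  have hedge : |ψ (u - s) - ψ (u₀ - s)| ≤ B →
      (s ∈ Icc (u₀ - 1 - δ) (u₀ - 1 + δ) ∨ s ∈ Icc (u₀ + 1 - δ) (u₀ + 1 + δ)) →
      |ψ (u - s) - ψ (u₀ - s)| ≤ modulus L B δ u₀ s := by
    intro hle hs
    refine hle.trans ?_
    have p1 : 0 ≤ (L : ℝ) * δ * (Icc (u₀ - 2) (u₀ + 2)).indicator (fun _ => (1 : ℝ)) s := by positivity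
    have p2 := mul_nonneg hB0 i2
    have p3 := mul_nonneg hB0 i3
    unfold modulus
    rcases hs with hs | hs
    · rw [indicator_of_mem hs] at p2 ⊢
      linarith
    · rw [indicator_of_mem hs] at p3 ⊢
      linarith
  by_cases h1 : u - s ∈ Ioo (-1 : ℝ) 1 <;> by_cases h2 : u₀ - s ∈ Ioo (-1 : ℝ) 1
  · have h3 := hL.dist_le_mul _ h1 _ h2
    rw [Real.dist_eq, Real.dist_eq, sub_sub_sub_cancel_right] at h3
    have h4 : s ∈ Icc (u₀ - 2) (u₀ + 2) := ⟨by linarith [h2.2], by linarith [h2.1]⟩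
    have h5 : (L : ℝ) * |u - u₀| ≤ L * δ := by gcongr
    unfold modulus
    rw [indicator_of_mem h4]
    have p2 := mul_nonneg hB0 i2
    have p3 := mul_nonneg hB0 i3
    linarith
  · refine hedge (by rw [hψ.zero _ h2, sub_zero]; exact hB _) ?_
    simp only [mem_Ioo, not_and_or, not_lt] at h2
    rcases h2 with h2 | h2
    · right; constructor <;> linarith [h1.1]
    · left; constructor <;> linarith [h1.2]
  · refine hedge (by rw [hψ.zero _ h1, zero_sub, abs_neg]; exact hB _) ?_
    simp only [mem_Ioo, not_and_or, not_lt] at h1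
    rcases h1 with h1 | h1
    · right; constructor <;> linarith [h2.1]
    · left; constructor <;> linarith [h2.2]
  · rw [hψ.zero _ h1, hψ.zero _ h2, sub_zero, abs_zero]
    exact modulus_nonneg hL0 hB0 hδ _ _

/-- The integral of the modulus is linear in |u - v|, so the function is even Lipschitz. -/
lemma continuous_setIntegral_mul_translate {ψ a : ℝ → ℝ} (hψ : IsKernelLike ψ) (ha : Measurable a)
    (hab : ∃ C, ∀ s, |a s| ≤ C) (A : Set ℝ) :
    Continuous fun u => ∫ s in A, a s * ψ (u - s) := by
  obtain ⟨L, B, hL, hB, hbd, hmod⟩ := hψ.exists_modulus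
  obtain ⟨C, hC⟩ := hab
  have hC0 : 0 ≤ C := (abs_nonneg _).trans (hC 0)
  have hint : ∀ u, IntegrableOn (fun s => a s * ψ (u - s)) A := fun u => by
    simpa only [mul_comm] using
      ((hψ.isTest.comp_sub_left u).mul_bdd ha ⟨C, hC⟩).integrable.integrableOn
  have key : ∀ u v, |(∫ s in A, a s * ψ (u - s)) - ∫ s in A, a s * ψ (v - s)|
      ≤ C * (4 * L + 4 * B) * |u - v| := by
    intro u v
    rw [← integral_sub (hint u) (hint v)]
    calc |∫ s in A, (a s * ψ (u - s) - a s * ψ (v - s))|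
        ≤ ∫ s in A, C * modulus L B |u - v| v s := by
          refine norm_integral_le_of_norm_le (f := fun s => a s * ψ (u - s) - a s * ψ (v - s))
            (((isTest_modulus _ _ _ _).const_mul C).integrable.integrableOn)
            (Eventually.of_forall fun s => ?_)
          rw [← mul_sub, norm_mul]
          exact mul_le_mul (hC s) (hmod _ _ _ _ (abs_nonneg _) le_rfl) (abs_nonneg _) hC0
      _ = C * ∫ s in A, modulus L B |u - v| v s := integral_const_mul _ _
      _ ≤ C * ((4 * L + 4 * B) * |u - v|) := by
          gcongr
          exact setIntegral_modulus_le hL hB (abs_nonneg _) _ _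
      _ = _ := by ring
  refine LipschitzWith.continuous (K := (C * (4 * L + 4 * B)).toNNReal)
    (LipschitzWith.of_dist_le_mul fun u v => ?_)
  rw [Real.dist_eq, Real.dist_eq, Real.coe_toNNReal _ (by positivity)]
  exact key u v

section Translate

variable {ι : Type*} {l : Filter ι} {n : ι → ℕ} {h : ι → ℝ} {z : ι → ℕ → ℝ} {A : Set ℝ} {c : ℝ}

/-- Convergence of `u ↦ (nh)⁻¹ ∑ᵢ aₙ(zᵢ) ψ(u - zᵢ)`, locally uniformly in `u`. -/
lemma EmpTendsto.tendsto_translate (hE : EmpTendsto l n h z (fun _ _ => 1) A c)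
    (hh : ∀ i, 0 < h i) (hz : ∀ R, ∀ᶠ i in l, ∀ j < n i, |z i j| ≤ R → z i j ∈ A)
    {ψ : ℝ → ℝ} (hψ : IsKernelLike ψ) {a : ι → ℝ → ℝ} {a₀ : ℝ → ℝ} (ham : Measurable a₀)
    (hab : ∃ C, ∀ s, |a₀ s| ≤ C) (hu : TendstoUniformlyOn a a₀ l A) (u₀ : ℝ) :
    Tendsto (fun q : ι × ℝ => empMean (n q.1) (h q.1) (z q.1) (fun _ => 1)
      (fun s => a q.1 s * ψ (q.2 - s))) (l ×ˢ 𝓝 u₀) (𝓝 (c * ∫ s in A, a₀ s * ψ (u₀ - s))) := by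
  obtain ⟨L, B, hL, hB, hbd, hmod⟩ := hψ.exists_modulus
  have hbd' : ∃ B, ∀ s ∈ A, |ψ (u₀ - s)| ≤ B := ⟨B, fun s _ => hbd _⟩
  have hab' := hab
  obtain ⟨C, hC⟩ := hab
  have hC0 : 0 ≤ C := (abs_nonneg _).trans (hC 0)
  have hone : ∀ (i : ι) (_ : ℕ), |(1 : ℝ)| ≤ 1 := fun _ _ => by simp
  have hsupp : ∀ s, |u₀| + 2 < |s| → ψ (u₀ - s) = 0 := fun s hs => by
    apply hψ.zero_of_one_le
    have := abs_sub_abs_le_abs_sub s u₀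
    rw [abs_sub_comm]; linarith
  have hpt : Tendsto (fun i => empMean (n i) (h i) (z i) (fun _ => 1)
      (fun s => a i s * ψ (u₀ - s))) l (𝓝 (c * ∫ s in A, a₀ s * ψ (u₀ - s))) := by
    refine hE.tendsto_of_tendstoUniformlyOn hE hone hh hz (R := |u₀| + 2) ?_ ?_ ?_ ?_
    · intro i s hs; rw [hsupp s hs, mul_zero]
    · simpa only [mul_comm] using (hψ.isTest.comp_sub_left u₀).mul_bdd ham hab'
    · intro s hs; rw [hsupp s hs, mul_zero]
    · refine tendstoUniformlyOn_mul_of_bdd hu ?_ ⟨C, fun s _ => hC s⟩ hbd'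
      rw [Metric.tendstoUniformlyOn_iff]
      exact fun ε hε => Eventually.of_forall fun i s _ => by rwa [dist_self]
  rw [Metric.tendsto_nhds] at hpt ⊢
  intro ε hε
  -- Near u₀ the translates change the mean by at most (C + 1) times the empirical mean of the
  -- modulus: C + 1 eventually bounds a on A, and the other factor bounds that empirical mean per
  -- unit of δ.
  set M := (C + 1) * (|c| * (4 * L + 4 * B) + 1) with hM
  have hMpos : 0 < M := by positivity
  obtain ⟨δ, hδ, hδ1, hδM⟩ : ∃ δ : ℝ, 0 < δ ∧ δ ≤ 1 ∧ M * δ ≤ ε / 2 :=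
    ⟨min 1 (ε / (2 * M)), by positivity, min_le_left _ _, by
      calc M * min 1 (ε / (2 * M)) ≤ M * (ε / (2 * M)) := by gcongr; exact min_le_right _ _
        _ = ε / 2 := by field_simp⟩
  have hD : ∀ᶠ i in l, empMean (n i) (h i) (z i) (fun _ => 1) (modulus L B δ u₀)
      < (|c| * (4 * L + 4 * B) + 1) * δ := by
    refine (hE _ (isTest_modulus L B δ u₀)).eventually (gt_mem_nhds ?_)
    have h1 := setIntegral_modulus_le hL hB hδ.le u₀ A
    have h0 : 0 ≤ ∫ s in A, modulus L B δ u₀ s :=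
      integral_nonneg fun s => modulus_nonneg hL hB hδ.le u₀ s
    calc c * ∫ s in A, modulus L B δ u₀ s ≤ |c| * ((4 * L + 4 * B) * δ) := by
          gcongr; exact le_abs_self c
      _ < (|c| * (4 * L + 4 * B) + 1) * δ := by nlinarith
  have hball : ∀ᶠ u in 𝓝 u₀, |u - u₀| ≤ δ := by
    filter_upwards [Metric.closedBall_mem_nhds u₀ hδ] with u hu
    rwa [← Real.dist_eq]
  filter_upwards [((((hpt (ε / 2) (by positivity)).and hD).and (hz (|u₀| + 3))).and
    (Metric.tendstoUniformlyOn_iff.1 hu 1 one_pos)).prod_mk hball]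
  rintro ⟨i, u⟩ ⟨⟨⟨⟨h1, h2⟩, h3⟩, h4⟩, h5⟩
  dsimp only at h1 h2 h3 h4 h5 ⊢
  -- Since δ ≤ 1, the modulus lives within distance 2 of u₀. Observations beyond |u₀| + 3, which
  -- need not lie in A and where a is not controlled, thus contribute nothing.
  have hmodsupp : ∀ s, |u₀| + 3 < |s| → modulus L B δ u₀ s = 0 := by
    intro s hs
    have hne : ∀ x y : ℝ, u₀ - 2 ≤ x → y ≤ u₀ + 2 → s ∉ Icc x y := by
      rintro x y hx hy ⟨hs1, hs2⟩
      have : |s - u₀| ≤ 2 := abs_le.2 ⟨by linarith, by linarith⟩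
      have := abs_sub_abs_le_abs_sub s u₀
      linarith
    unfold modulus
    rw [indicator_of_notMem (hne _ _ le_rfl le_rfl),
      indicator_of_notMem (hne _ _ (by linarith) (by linarith)),
      indicator_of_notMem (hne _ _ (by linarith) (by linarith))]
    ring
  have hdiff : |empMean (n i) (h i) (z i) (fun _ => 1) (fun s => a i s * ψ (u - s)) -
      empMean (n i) (h i) (z i) (fun _ => 1) (fun s => a i s * ψ (u₀ - s))| ≤
      (C + 1) * empMean (n i) (h i) (z i) (fun _ => 1) (modulus L B δ u₀) := by
    rw [← empMean_sub, ← empMean_const_mul]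
    refine abs_empMean_le (hh i) (fun _ => by simp) fun j hj => ?_
    have hm := hmod δ u₀ u (z i j) hδ.le h5
    rw [← mul_sub, abs_mul]
    by_cases hR : |z i j| ≤ |u₀| + 3
    · have h6 := h4 _ (h3 j hj hR)
      rw [dist_comm, Real.dist_eq] at h6
      have h7 := abs_sub_abs_le_abs_sub (a i (z i j)) (a₀ (z i j))
      have h8 := hC (z i j)
      exact mul_le_mul (by linarith) hm (abs_nonneg _) (by positivity)
    · have h6 := hmodsupp _ (not_le.1 hR)
      rw [h6] at hm ⊢
      rw [le_antisymm hm (abs_nonneg _), mul_zero, mul_zero]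
  have h9 : (C + 1) * empMean (n i) (h i) (z i) (fun _ => 1) (modulus L B δ u₀) ≤ ε / 2 := by
    calc _ ≤ (C + 1) * ((|c| * (4 * L + 4 * B) + 1) * δ) := by gcongr
      _ = M * δ := by rw [hM]; ring
      _ ≤ ε / 2 := hδM
  rw [Real.dist_eq] at h1 ⊢
  calc _ ≤ _ := abs_sub_le _ (empMean (n i) (h i) (z i) (fun _ => 1) (fun s => a i s * ψ (u₀ - s))) _
    _ < ε / 2 + ε / 2 := add_lt_add_of_le_of_lt (hdiff.trans h9) h1
    _ = ε := by ring

end Translate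

/-! ### Local limits of local polynomial estimators -/

/-- The translate `A - s`. -/
def shiftSet (A : Set ℝ) (s : ℝ) : Set ℝ := (fun u => s + u) ⁻¹' A

lemma shiftSet_zero (A : Set ℝ) : shiftSet A 0 = A := by simp [shiftSet]

/-- The function `u ↦ u^m K(u)`. -/
def monoKernel (K : ℝ → ℝ) (m : ℕ) (u : ℝ) : ℝ := u ^ m * K u

/-- The rescaled observations `(xⱼ - t₀) / h`. -/
def scaledObs {ι : Type*} (h : ι → ℝ) (X : ι → ℕ → ℝ) (t₀ : ℝ) (i : ι) (j : ℕ) : ℝ :=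
  (X i j - t₀) / h i

/-- Along the filter `l`, the rescaled sample near `t₀` behaves like a sample with density `c` on
`A`, regression value `g₀` and conditional second moment `v₀`. -/
structure LocalLimits {ι : Type*} (l : Filter ι) (n : ι → ℕ) (h : ι → ℝ) (X Y : ι → ℕ → ℝ)
    (t₀ : ℝ) (A : Set ℝ) (c g₀ v₀ : ℝ) : Prop where
  h_pos : ∀ i, 0 < h i
  tendsto_n : Tendsto n l atTop
  tendsto_nh : Tendsto (fun i => n i * h i) l atTop
  isClosed_A : IsClosed A
  zero_mem : (0 : ℝ) ∈ A
  add_mem : ∀ s ∈ A, ∀ u, 0 ≤ u → s + u ∈ A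
  c_pos : 0 < c
  mem_A : ∀ R, ∀ᶠ i in l, ∀ j < n i, |scaledObs h X t₀ i j| ≤ R → scaledObs h X t₀ i j ∈ A
  mom_zero : EmpTendsto l n h (scaledObs h X t₀) (fun _ _ => 1) A c
  mom_one : EmpTendsto l n h (scaledObs h X t₀) Y A (c * g₀)
  mom_two : EmpTendsto l n h (scaledObs h X t₀) (fun i j => Y i j ^ 2) A (c * v₀)

/-- The limit of the convolved weights over the domain `A`. -/
def convOn (K : ℝ → ℝ) (p : ℕ) (A : Set ℝ) (u : ℝ) : ℝ :=
  ∫ r in A, eqKernel K p (shiftSet A 0) r * eqKernel K p (shiftSet A r) (u - r)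

/-- The limit of `C_n(t₀ + s h)` over the domain `A`. -/
def biasConst (K : ℝ → ℝ) (p : ℕ) (A : Set ℝ) (s : ℝ) : ℝ :=
  ∫ u in shiftSet A s, eqKernel K p (shiftSet A s) u * u ^ (p + 1)

/-- The limit of `C_{LP,n}(t₀)` over the domain `A`. -/
def biasConstLP (K : ℝ → ℝ) (p : ℕ) (A : Set ℝ) : ℝ :=
  ∫ s in A, eqKernel K p (shiftSet A 0) s * biasConst K p A s

lemma tendsto_matrix_inv {α m : Type*} [Fintype m] [DecidableEq m] {l : Filter α}
    {M : α → Matrix m m ℝ} {M₀ : Matrix m m ℝ} (hM : Tendsto M l (𝓝 M₀)) (h0 : M₀.det ≠ 0) :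
    Tendsto (fun a => (M a)⁻¹) l (𝓝 M₀⁻¹) := by
  simp only [Matrix.inv_def, Ring.inverse_eq_inv']
  have h1 : Tendsto (fun a => (M a).det) l (𝓝 M₀.det) :=
    ((continuous_id.matrix_det).tendsto M₀).comp hM
  have h2 : Tendsto (fun a => (M a).adjugate) l (𝓝 M₀.adjugate) :=
    ((continuous_id.matrix_adjugate).tendsto M₀).comp hM
  exact (h1.inv₀ h0).smul h2

lemma tendstoUniformlyOn_comp_const {ι : Type*} {l : Filter ι} {F : ι → ℝ → ℝ} {a : ℝ} {S : Set ℝ}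
    {g : ℝ → ℝ} (hF : TendstoUniformlyOn F (fun _ => a) l S) (hg : ContinuousAt g a) :
    TendstoUniformlyOn (fun i u => g (F i u)) (fun _ => g a) l S := by
  rw [Metric.tendstoUniformlyOn_iff] at hF ⊢
  intro ε hε
  obtain ⟨δ, hδ, H⟩ := Metric.continuousAt_iff.1 hg ε hε
  filter_upwards [hF δ hδ] with i hi u hu
  rw [dist_comm]
  exact H (by rw [dist_comm]; exact hi u hu)

lemma IsTest.of_continuousOn {f : ℝ → ℝ} {S : Set ℝ} (hS : IsCompact S) (hf : ContinuousOn f S) :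
    IsTest (S.indicator f) := by
  classical
  obtain ⟨C, hC⟩ := hS.exists_bound_of_continuousOn hf
  obtain ⟨R, hR⟩ := hS.isBounded.exists_norm_le
  refine ⟨?_, ⟨max C 0, fun u => ?_⟩, R, fun u hu => indicator_of_notMem (fun h => ?_) _⟩
  · have := ContinuousOn.measurable_piecewise (g := fun _ => (0 : ℝ)) hf continuousOn_const
      hS.isClosed.measurableSet
    convert this using 1
    funext u
    by_cases hu : u ∈ S
    · rw [piecewise_eq_of_mem _ _ _ hu, indicator_of_mem hu]
    · rw [piecewise_eq_of_notMem _ _ _ hu, indicator_of_notMem hu]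
  · by_cases hu : u ∈ S
    · rw [indicator_of_mem hu]; exact (hC u hu).trans (le_max_left _ _)
    · rw [indicator_of_notMem hu, abs_zero]; exact le_max_right _ _
  · exact absurd (hR u h) (not_le.2 hu)

lemma IsTest.of_continuous {f : ℝ → ℝ} (hf : Continuous f) {R : ℝ} (hR : ∀ u, R < |u| → f u = 0) :
    IsTest f := by
  have h := IsTest.of_continuousOn (isCompact_Icc (a := -R) (b := R)) hf.continuousOn
  convert h using 1
  funext u
  by_cases hu : u ∈ Icc (-R) R
  · rw [indicator_of_mem hu]
  · rw [indicator_of_notMem hu, hR u (not_le.1 fun h => hu (abs_le.1 h))]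

lemma setIntegral_comp_sub (φ : ℝ → ℝ) (A : Set ℝ) (s : ℝ) :
    ∫ v in A, φ (v - s) = ∫ u in shiftSet A s, φ u := by
  have h := (measurePreserving_add_left volume s).setIntegral_preimage_emb
    (measurableEmbedding_addLeft s) (fun v => φ (v - s)) A
  rw [← h]
  simp [shiftSet]

/-! ### Regularity of the limiting kernels and constants in the evaluation point -/

section Kernel

variable {K : ℝ → ℝ} (hK : IsKernelLike K)
include hK

lemma isKernelLike_monoKernel (m : ℕ) : IsKernelLike (monoKernel K m) := hK.pow_mul m

/-- A translation moves the dependence on s from the domain to the integrand, where the modulus of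
the kernel applies. -/
lemma continuous_setIntegral_monoKernel_shift (A : Set ℝ) (m : ℕ) :
    Continuous fun s => ∫ u in shiftSet A s, u ^ m * K u := by
  have h := continuous_setIntegral_mul_translate (isKernelLike_monoKernel hK m).comp_neg
    (a := fun _ => 1) measurable_const ⟨1, fun _ => by simp⟩ A
  simp only [one_mul, neg_sub] at h
  convert h using 2 with s
  exact (setIntegral_comp_sub (monoKernel K m) A s).symm

lemma continuous_kernelMoment_shift (A : Set ℝ) (p : ℕ) :
    Continuous fun s => kernelMoment K p (shiftSet A s) := by
  refine continuous_pi fun j => continuous_pi fun k => ?_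
  exact continuous_setIntegral_monoKernel_shift hK A _

lemma isTest_eqKernel (p : ℕ) (B : Set ℝ) : IsTest (eqKernel K p B) := by
  have : eqKernel K p B = fun u => ∑ k : Fin (p + 1), eqCoeff K p B k * (u ^ (k : ℕ) * K u) := by
    funext u; exact eqKernel_eq_sum p u
  rw [this]
  exact IsTest.sum _ fun k _ => (hK.pow_mul _).isTest.const_mul _

lemma eqKernel_eq_zero (p : ℕ) (B : Set ℝ) {u : ℝ} (hu : 1 ≤ |u|) : eqKernel K p B u = 0 := by
  rw [eqKernel, hK.zero_of_one_le hu, mul_zero]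

lemma convOn_eq_zero (p : ℕ) (A : Set ℝ) {u : ℝ} (hu : 2 ≤ |u|) : convOn K p A u = 0 := by
  refine integral_eq_zero_of_ae (Eventually.of_forall fun r => ?_)
  change _ * _ = (0 : ℝ)
  by_cases hr : 1 ≤ |r|
  · rw [eqKernel_eq_zero hK p _ hr, zero_mul]
  · rw [eqKernel_eq_zero hK p _ (u := u - r), mul_zero]
    have := abs_sub_abs_le_abs_sub u r
    linarith [not_le.1 hr]

variable (hpos : ∀ u ∈ Ioo (-1 : ℝ) 1, 0 < K u)
include hpos

/-- Because A is stable under adding nonnegative numbers, A - s contains (0, 1) for every s in A. -/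
lemma kernelMoment_shift_det_ne_zero {A : Set ℝ} (hA : MeasurableSet A)
    (hadd : ∀ s ∈ A, ∀ u, 0 ≤ u → s + u ∈ A) (p : ℕ) {s : ℝ} (hs : s ∈ A) :
    (kernelMoment K p (shiftSet A s)).det ≠ 0 :=
  kernelMoment_det_ne_zero hK hpos (measurable_const_add s hA)
    (fun u hu => hadd s hs u hu.1.le) p

lemma continuousOn_eqCoeff {A : Set ℝ} (hA : MeasurableSet A)
    (hadd : ∀ s ∈ A, ∀ u, 0 ≤ u → s + u ∈ A) (p : ℕ) (k : Fin (p + 1)) :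
    ContinuousOn (fun s => eqCoeff K p (shiftSet A s) k) A := by
  intro s hs
  have h1 := tendsto_matrix_inv
    ((continuous_kernelMoment_shift hK A p).continuousWithinAt (s := A) (x := s)).tendsto
    (kernelMoment_shift_det_ne_zero hK hpos hA hadd p hs)
  exact (tendsto_pi_nhds.1 (tendsto_pi_nhds.1 h1 0) k)

lemma isTest_eqCoeff {A : Set ℝ} (hA : IsClosed A)
    (hadd : ∀ s ∈ A, ∀ u, 0 ≤ u → s + u ∈ A) (p : ℕ) (k : Fin (p + 1)) :
    IsTest ((A ∩ Icc (-1) 1).indicator fun s => eqCoeff K p (shiftSet A s) k) :=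
  IsTest.of_continuousOn (isCompact_Icc.inter_left hA)
    ((continuousOn_eqCoeff hK hpos hA.measurableSet hadd p k).mono inter_subset_left)

omit hpos in
-- Expanding the inner kernel in monomials separates its two dependences on s: the coefficients
-- become part of the amplitude, and a pure translate remains. Truncating the coefficients to a
-- compact set costs nothing, since the outer kernel vanishes elsewhere, and makes them test
-- functions.
lemma convOn_eq_sum {A : Set ℝ} (hA : IsClosed A) (p : ℕ)
    (ht : ∀ k : Fin (p + 1),
      IsTest ((A ∩ Icc (-1) 1).indicator fun s => eqCoeff K p (shiftSet A s) k)) (u : ℝ) :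
    convOn K p A u = ∑ k : Fin (p + 1), ∫ s in A, (eqKernel K p (shiftSet A 0) s *
      (A ∩ Icc (-1) 1).indicator (fun s => eqCoeff K p (shiftSet A s) k) s) *
        monoKernel K k (u - s) := by
  rw [convOn, ← integral_finsetSum]
  · refine setIntegral_congr_fun hA.measurableSet fun s hs => ?_
    by_cases h1 : s ∈ Icc (-1 : ℝ) 1
    · simp only [eqKernel_eq_sum (B := shiftSet A s), Finset.mul_sum, monoKernel, mul_assoc,
        indicator_of_mem (show s ∈ A ∩ Icc (-1) 1 from ⟨hs, h1⟩)]
    · have : eqKernel K p (shiftSet A 0) s = 0 :=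
        eqKernel_eq_zero hK p _ (not_lt.1 fun h => h1 (abs_le.1 h.le))
      simp [this]
  · intro k _
    exact (((isTest_eqKernel hK p _).mul (ht k)).mul
      ((isKernelLike_monoKernel hK k).isTest.comp_sub_left u)).integrable.integrableOn

lemma continuous_convOn {A : Set ℝ} (hA : IsClosed A)
    (hadd : ∀ s ∈ A, ∀ u, 0 ≤ u → s + u ∈ A) (p : ℕ) : Continuous (convOn K p A) := by
  have ht := isTest_eqCoeff hK hpos hA hadd p
  have : convOn K p A = fun u => _ := funext fun u => convOn_eq_sum hK hA p ht u
  rw [this]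
  refine continuous_finsetSum _ fun k _ => ?_
  have h1 := (isTest_eqKernel hK p (shiftSet A 0)).mul (ht k)
  exact continuous_setIntegral_mul_translate (isKernelLike_monoKernel hK k) h1.measurable h1.bdd A

lemma isTest_convOn {A : Set ℝ} (hA : IsClosed A)
    (hadd : ∀ s ∈ A, ∀ u, 0 ≤ u → s + u ∈ A) (p : ℕ) : IsTest (convOn K p A) :=
  IsTest.of_continuous (R := 2) (continuous_convOn hK hpos hA hadd p)
    fun _ hu => convOn_eq_zero hK p A hu.le

omit hpos in
lemma biasConst_eq_sum (A : Set ℝ) (p : ℕ) (s : ℝ) :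
    biasConst K p A s = ∑ k : Fin (p + 1), eqCoeff K p (shiftSet A s) k *
      ∫ u in shiftSet A s, u ^ ((k : ℕ) + (p + 1)) * K u :=
  setIntegral_eqKernel_mul_pow hK p (p + 1)

lemma continuousOn_biasConst {A : Set ℝ} (hA : MeasurableSet A)
    (hadd : ∀ s ∈ A, ∀ u, 0 ≤ u → s + u ∈ A) (p : ℕ) : ContinuousOn (biasConst K p A) A := by
  have : biasConst K p A = fun s => _ := funext fun s => biasConst_eq_sum hK A p s
  rw [this]
  exact continuousOn_finsetSum _ fun k _ => (continuousOn_eqCoeff hK hpos hA hadd p k).mul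
    (continuous_setIntegral_monoKernel_shift hK A _).continuousOn

end Kernel

/-! ### Finite-sample quantities as empirical means of translates -/

section Finite

variable {K : ℝ → ℝ} {p n : ℕ} {h t₀ : ℝ} {X : ℕ → ℝ}

/-- The first row of `Γ_p(t)⁻¹`. -/
def coeffHat (K : ℝ → ℝ) (p n : ℕ) (h : ℝ) (X : ℕ → ℝ) (t : ℝ) (k : Fin (p + 1)) : ℝ :=
  (gramMatrix K p n h X t)⁻¹ 0 k

lemma weight_eq_sum (j : ℕ) (t : ℝ) :
    weight K p n h X j t = ∑ k, coeffHat K p n h X t k * monoKernel K k ((X j - t) / h) := by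
  simp only [weight, Matrix.mulVec, dotProduct, rVec, Finset.sum_mul, coeffHat, mul_assoc, monoKernel]

lemma gramMatrix_apply (q : ℕ) (s : ℝ) (hh : 0 < h) (j k : Fin (q + 1)) :
    gramMatrix K q n h X (t₀ + s * h) j k = empMean n h (fun j => (X j - t₀) / h) (fun _ => 1)
      (fun v => monoKernel K ((j : ℕ) + k) (v - s)) := by
  simp only [gramMatrix, Matrix.of_apply, empMean, monoKernel, mul_one]
  congr 1
  refine Finset.sum_congr rfl fun i _ => ?_
  have : (X i - (t₀ + s * h)) / h = (X i - t₀) / h - s := by field_simp; ring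
  rw [this, mul_comm]

lemma Cn_eq_sum (s : ℝ) (hh : 0 < h) :
    Cn K p n h X (t₀ + s * h) = ∑ k, coeffHat K p n h X (t₀ + s * h) k *
      empMean n h (fun j => (X j - t₀) / h) (fun _ => 1)
        (fun v => monoKernel K ((k : ℕ) + (p + 1)) (v - s)) := by
  simp only [Cn, weight_eq_sum, empMean, monoKernel, mul_one, Finset.sum_mul, Finset.mul_sum]
  rw [Finset.sum_comm]
  refine Finset.sum_congr rfl fun k _ => Finset.sum_congr rfl fun i _ => ?_
  have : (X i - (t₀ + s * h)) / h = (X i - t₀) / h - s := by field_simp; ring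
  rw [this]
  ring

end Finite

/-! ### Limits of the weights and scaling constants -/

section Limits

variable {ι : Type*} {l : Filter ι} {n : ι → ℕ} {h : ι → ℝ} {X Y : ι → ℕ → ℝ} {t₀ : ℝ} {A : Set ℝ}
  {c g₀ v₀ : ℝ} (hD : LocalLimits l n h X Y t₀ A c g₀ v₀) {K : ℝ → ℝ} (hK : IsKernelLike K) {p : ℕ}
include hD hK

lemma LocalLimits.tendsto_empMean_shift (m : ℕ) (s : ℝ) :
    Tendsto (fun q : ι × ℝ => empMean (n q.1) (h q.1) (scaledObs h X t₀ q.1) (fun _ => 1)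
      (fun v => monoKernel K m (v - q.2))) (l ×ˢ 𝓝 s)
      (𝓝 (c * ∫ u in shiftSet A s, u ^ m * K u)) := by
  have h1 := hD.mom_zero.tendsto_translate hD.h_pos hD.mem_A
    (isKernelLike_monoKernel hK m).comp_neg (a := fun _ _ => 1) (a₀ := fun _ => 1) measurable_const
    ⟨1, fun _ => by simp⟩ (tendstoUniformlyOn_of_tendsto tendsto_const_nhds A) s
  simp only [one_mul, neg_sub] at h1
  rw [setIntegral_comp_sub (monoKernel K m) A s] at h1
  exact h1

lemma LocalLimits.tendsto_gramMatrix (q : ℕ) (s : ℝ) :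
    Tendsto (fun r : ι × ℝ => gramMatrix K q (n r.1) (h r.1) (X r.1) (t₀ + r.2 * h r.1))
      (l ×ˢ 𝓝 s) (𝓝 (c • kernelMoment K q (shiftSet A s))) := by
  refine tendsto_pi_nhds.2 fun j => tendsto_pi_nhds.2 fun k => ?_
  simp only [gramMatrix_apply q _ (hD.h_pos _)]
  exact hD.tendsto_empMean_shift hK _ s

lemma LocalLimits.tendsto_gramMatrix_center (q : ℕ) :
    Tendsto (fun i => gramMatrix K q (n i) (h i) (X i) t₀) l (𝓝 (c • kernelMoment K q A)) := by
  have h1 := (hD.tendsto_gramMatrix hK q 0).comp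
    (tendsto_id.prodMk (tendsto_const_nhds (x := (0 : ℝ))))
  simpa [Function.comp_def, shiftSet_zero] using h1

variable (hpos : ∀ u ∈ Ioo (-1 : ℝ) 1, 0 < K u)
include hpos

lemma LocalLimits.tendsto_gramMatrix_inv_center (q : ℕ) :
    Tendsto (fun i => (gramMatrix K q (n i) (h i) (X i) t₀)⁻¹) l
      (𝓝 (c • kernelMoment K q A)⁻¹) := by
  refine tendsto_matrix_inv (hD.tendsto_gramMatrix_center hK q) ?_
  have := kernelMoment_shift_det_ne_zero hK hpos hD.isClosed_A.measurableSet hD.add_mem q hD.zero_mem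
  rw [shiftSet_zero] at this
  rw [Matrix.det_smul]
  exact mul_ne_zero (pow_ne_zero _ hD.c_pos.ne') this

lemma LocalLimits.tendsto_coeffHat {s : ℝ} (hs : s ∈ A) (k : Fin (p + 1)) :
    Tendsto (fun r : ι × ℝ => coeffHat K p (n r.1) (h r.1) (X r.1) (t₀ + r.2 * h r.1) k)
      (l ×ˢ 𝓝 s) (𝓝 (c⁻¹ * eqCoeff K p (shiftSet A s) k)) := by
  have hdet := kernelMoment_shift_det_ne_zero hK hpos hD.isClosed_A.measurableSet hD.add_mem p hs
  have h1 := tendsto_matrix_inv (hD.tendsto_gramMatrix hK p s) (by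
    rw [Matrix.det_smul]
    exact mul_ne_zero (pow_ne_zero _ hD.c_pos.ne') hdet)
  have h2 := tendsto_pi_nhds.1 (tendsto_pi_nhds.1 h1 0) k
  have hinv : (c • kernelMoment K p (shiftSet A s))⁻¹ = c⁻¹ • (kernelMoment K p (shiftSet A s))⁻¹ := by
    apply Matrix.inv_eq_left_inv
    rw [Matrix.smul_mul, Matrix.mul_smul, smul_smul, inv_mul_cancel₀ hD.c_pos.ne', one_smul,
      Matrix.nonsing_inv_mul _ (isUnit_iff_ne_zero.2 hdet)]
  rw [hinv] at h2
  exact h2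

lemma LocalLimits.tendsto_coeffHat_center (k : Fin (p + 1)) :
    Tendsto (fun i => coeffHat K p (n i) (h i) (X i) t₀ k) l
      (𝓝 (c⁻¹ * eqCoeff K p (shiftSet A 0) k)) := by
  have h1 := (hD.tendsto_coeffHat hK hpos hD.zero_mem k).comp
    (tendsto_id.prodMk (tendsto_const_nhds (x := (0 : ℝ))))
  simpa [Function.comp_def] using h1

/-- The evaluation points that enter the convolved weights are observations, so pointwise limits of
the coefficients would not suffice. The indicator changes nothing on this set and turns the limit
into a test function. -/
lemma LocalLimits.tendstoUniformlyOn_coeffHat (k : Fin (p + 1)) :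
    TendstoUniformlyOn (fun i s => coeffHat K p (n i) (h i) (X i) (t₀ + s * h i) k)
      (fun s => c⁻¹ * (A ∩ Icc (-1) 1).indicator (fun s => eqCoeff K p (shiftSet A s) k) s) l
      (A ∩ Icc (-1) 1) := by
  have hc : IsCompact (A ∩ Icc (-1 : ℝ) 1) := isCompact_Icc.inter_left hD.isClosed_A
  have h1 : TendstoUniformlyOn (fun i s => coeffHat K p (n i) (h i) (X i) (t₀ + s * h i) k)
      (fun s => c⁻¹ * eqCoeff K p (shiftSet A s) k) l (A ∩ Icc (-1) 1) := by
    refine tendstoUniformlyOn_of_forall_tendsto hc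
      (continuousOn_const.mul ((continuousOn_eqCoeff hK hpos hD.isClosed_A.measurableSet
        hD.add_mem p k).mono inter_subset_left)) fun s hs => ?_
    exact (hD.tendsto_coeffHat hK hpos hs.1 k).mono_left
      (Filter.prod_mono le_rfl nhdsWithin_le_nhds)
  exact h1.congr_right fun s hs => by simp only [indicator_of_mem hs]

lemma LocalLimits.tendstoUniformlyOn_weight :
    TendstoUniformlyOn (fun i u => ∑ k, coeffHat K p (n i) (h i) (X i) t₀ k * monoKernel K k u)
      (fun u => c⁻¹ * eqKernel K p (shiftSet A 0) u) l A := by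
  have h1 : (fun u => c⁻¹ * eqKernel K p (shiftSet A 0) u) = fun u =>
      ∑ k : Fin (p + 1), c⁻¹ * eqCoeff K p (shiftSet A 0) k * monoKernel K k u := by
    funext u
    simp only [eqKernel_eq_sum, Finset.mul_sum, monoKernel, mul_assoc]
  rw [h1]
  refine tendstoUniformlyOn_sum _ fun k _ => ?_
  obtain ⟨B, hB⟩ := (isKernelLike_monoKernel hK k).bdd
  refine tendstoUniformlyOn_mul_of_bdd
    (tendstoUniformlyOn_of_tendsto (hD.tendsto_coeffHat_center hK hpos k) A) ?_
    ⟨_, fun _ _ => le_rfl⟩ ⟨B, fun u _ => hB u⟩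
  rw [Metric.tendstoUniformlyOn_iff]
  exact fun ε hε => Eventually.of_forall fun i s _ => by rwa [dist_self]

/-- The convolved weights, as a function of the rescaled position. -/
def convHat (K : ℝ → ℝ) (p n : ℕ) (h : ℝ) (X : ℕ → ℝ) (t₀ : ℝ) (u : ℝ) : ℝ :=
  ∑ k : Fin (p + 1), empMean n h (fun j => (X j - t₀) / h) (fun _ => 1) (fun s =>
    ((∑ m, coeffHat K p n h X t₀ m * monoKernel K m s) * coeffHat K p n h X (t₀ + s * h) k) *
      monoKernel K k (u - s))

omit hD hpos in
lemma sum_coeffHat_mul_monoKernel_eq_zero {n : ℕ} {h : ℝ} {X : ℕ → ℝ} {u : ℝ} (hu : 1 ≤ |u|) :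
    ∑ m, coeffHat K p n h X t₀ m * monoKernel K m u = 0 :=
  Finset.sum_eq_zero fun m _ => by
    rw [(isKernelLike_monoKernel hK m).zero_of_one_le hu, mul_zero]

omit hD hpos in
lemma convHat_eq_zero {n : ℕ} {h : ℝ} {X : ℕ → ℝ} {u : ℝ} (hu : 2 ≤ |u|) :
    convHat K p n h X t₀ u = 0 := by
  refine Finset.sum_eq_zero fun k _ => ?_
  rw [empMean, Finset.sum_eq_zero, mul_zero]
  intro j _
  by_cases hr : 1 ≤ |(X j - t₀) / h|
  · rw [sum_coeffHat_mul_monoKernel_eq_zero hK hr]; ring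
  · rw [(isKernelLike_monoKernel hK k).zero_of_one_le (u := u - _), mul_zero, zero_mul]
    have := abs_sub_abs_le_abs_sub u ((X j - t₀) / h)
    linarith [not_le.1 hr]

/-- Each summand is an empirical convolution with a uniformly convergent amplitude, to which
`tendsto_translate` applies. The two inverse Gram matrices contribute c⁻² and the empirical mean
contributes c, which leaves c⁻¹. -/
lemma LocalLimits.tendstoUniformlyOn_convHat :
    TendstoUniformlyOn (fun i u => convHat K p (n i) (h i) (X i) t₀ u)
      (fun u => c⁻¹ * convOn K p A u) l A := by
  refine tendstoUniformlyOn_of_inter_Icc (R := 2) ?_ (fun i u hu => convHat_eq_zero hK hu.le)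
    (fun u hu => by rw [convOn_eq_zero hK p A hu.le, mul_zero])
  refine tendstoUniformlyOn_of_forall_tendsto (isCompact_Icc.inter_left hD.isClosed_A)
    (continuous_const.mul
      (continuous_convOn hK hpos hD.isClosed_A hD.add_mem p)).continuousOn fun u _ => ?_
  refine Tendsto.mono_left ?_ (Filter.prod_mono le_rfl nhdsWithin_le_nhds)
  have ht := isTest_eqCoeff hK hpos hD.isClosed_A hD.add_mem p
  rw [convOn_eq_sum hK hD.isClosed_A p ht, Finset.mul_sum]
  refine tendsto_finsetSum _ fun k _ => ?_
  have hw := (isTest_eqKernel hK p (shiftSet A 0)).const_mul c⁻¹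
  have hα := (ht k).const_mul c⁻¹
  have h1 := hD.mom_zero.tendsto_translate hD.h_pos hD.mem_A (isKernelLike_monoKernel hK k)
    (a := fun i s => (∑ m, coeffHat K p (n i) (h i) (X i) t₀ m * monoKernel K m s) *
      coeffHat K p (n i) (h i) (X i) (t₀ + s * h i) k)
    (a₀ := fun s => (c⁻¹ * eqKernel K p (shiftSet A 0) s) *
      (c⁻¹ * (A ∩ Icc (-1) 1).indicator (fun s => eqCoeff K p (shiftSet A s) k) s))
    (hw.mul hα).measurable (hw.mul hα).bdd (tendstoUniformlyOn_of_inter_Icc (R := 1)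
      (tendstoUniformlyOn_mul_of_bdd
        ((hD.tendstoUniformlyOn_weight hK hpos).mono inter_subset_left)
        (hD.tendstoUniformlyOn_coeffHat hK hpos k)
        (hw.bdd.imp fun B hB u _ => hB u) (hα.bdd.imp fun B hB u _ => hB u))
      (fun i u hu => by rw [sum_coeffHat_mul_monoKernel_eq_zero hK hu.le, zero_mul])
      (fun u hu => by rw [eqKernel_eq_zero hK p _ hu.le]; ring)) u
  convert h1 using 2
  · rfl
  rw [← integral_const_mul, ← integral_const_mul]
  congr 1; funext s
  have := hD.c_pos.ne'
  field_simp

lemma LocalLimits.tendsto_Cn {s : ℝ} (hs : s ∈ A) :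
    Tendsto (fun r : ι × ℝ => Cn K p (n r.1) (h r.1) (X r.1) (t₀ + r.2 * h r.1))
      (l ×ˢ 𝓝 s) (𝓝 (biasConst K p A s)) := by
  simp only [Cn_eq_sum _ (hD.h_pos _)]
  rw [biasConst_eq_sum hK]
  refine tendsto_finsetSum _ fun k _ => ?_
  have h1 := (hD.tendsto_coeffHat hK hpos hs k).mul
    (hD.tendsto_empMean_shift hK ((k : ℕ) + (p + 1)) s)
  convert h1 using 2
  · rfl
  have := hD.c_pos.ne'
  field_simp

/-- Uniform convergence of s ↦ C_n(t₀ + s h) on A ∩ [-1, 1] allows the inner constants to be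
replaced by their limits inside the outer mean. The factor c⁻¹ of the weights cancels the density c.
-/
lemma LocalLimits.tendsto_CLPn :
    Tendsto (fun i => CLPn K p (n i) (h i) (X i) t₀) l (𝓝 (biasConstLP K p A)) := by
  have hc : IsCompact (A ∩ Icc (-1 : ℝ) 1) := isCompact_Icc.inter_left hD.isClosed_A
  have hcont : ContinuousOn (biasConst K p A) (A ∩ Icc (-1) 1) :=
    (continuousOn_biasConst hK hpos hD.isClosed_A.measurableSet hD.add_mem p).mono inter_subset_left
  have htb := IsTest.of_continuousOn hc hcont
  have hw := (isTest_eqKernel hK p (shiftSet A 0)).const_mul c⁻¹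
  have hu : TendstoUniformlyOn (fun i s => Cn K p (n i) (h i) (X i) (t₀ + s * h i))
      ((A ∩ Icc (-1) 1).indicator (biasConst K p A)) l (A ∩ Icc (-1) 1) :=
    (tendstoUniformlyOn_of_forall_tendsto hc hcont fun s hs => (hD.tendsto_Cn hK hpos hs.1).mono_left
      (Filter.prod_mono le_rfl nhdsWithin_le_nhds)).congr_right fun s hs => by
        simp only [indicator_of_mem hs]
  have h1 := hD.mom_zero.tendsto_of_tendstoUniformlyOn hD.mom_zero (fun _ _ => by simp) hD.h_pos
    hD.mem_A (R := 1)
    (F := fun i u => (∑ m, coeffHat K p (n i) (h i) (X i) t₀ m * monoKernel K m u) *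
      Cn K p (n i) (h i) (X i) (t₀ + u * h i))
    (G := fun u => (c⁻¹ * eqKernel K p (shiftSet A 0) u) *
      (A ∩ Icc (-1) 1).indicator (biasConst K p A) u)
    (fun i u hu => by rw [sum_coeffHat_mul_monoKernel_eq_zero hK hu.le, zero_mul])
    (hw.mul htb) (fun u hu => by rw [eqKernel_eq_zero hK p _ hu.le]; ring)
    (tendstoUniformlyOn_of_inter_Icc (R := 1) (tendstoUniformlyOn_mul_of_bdd
      ((hD.tendstoUniformlyOn_weight hK hpos).mono inter_subset_left) hu
        (hw.bdd.imp fun B hB u _ => hB u) (htb.bdd.imp fun B hB u _ => hB u))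
      (fun i u hu => by rw [sum_coeffHat_mul_monoKernel_eq_zero hK hu.le, zero_mul])
      (fun u hu => by rw [eqKernel_eq_zero hK p _ hu.le]; ring))
  convert h1 using 2
  · rename_i i
    simp only [CLPn, empMean, weight_eq_sum, mul_one, scaledObs]
    congr 1
    refine Finset.sum_congr rfl fun j _ => ?_
    rw [div_mul_cancel₀ _ (hD.h_pos i).ne', add_sub_cancel]
  · rw [biasConstLP, ← integral_const_mul]
    refine setIntegral_congr_fun hD.isClosed_A.measurableSet fun s hs => ?_
    have := hD.c_pos.ne'
    by_cases h2 : s ∈ Icc (-1 : ℝ) 1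
    · simp only [indicator_of_mem (show s ∈ A ∩ Icc (-1) 1 from ⟨hs, h2⟩)]
      field_simp
    · have : eqKernel K p (shiftSet A 0) s = 0 :=
        eqKernel_eq_zero hK p _ (not_lt.1 fun h => h2 (abs_le.1 h.le))
      simp [this]

lemma LocalLimits.tendsto_Qn (hC : biasConstLP K p A ≠ 0) :
    Tendsto (fun i => Qn K p (n i) (h i) (X i) t₀) l
      (𝓝 (biasConst K p A 0 / biasConstLP K p A)) := by
  have h1 := (hD.tendsto_Cn (p := p) hK hpos hD.zero_mem).comp
    (tendsto_id.prodMk (tendsto_const_nhds (x := (0 : ℝ))))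
  have h2 : Tendsto (fun i => Cn K p (n i) (h i) (X i) t₀) l (𝓝 (biasConst K p A 0)) := by
    simpa [Function.comp_def] using h1
  exact h2.div (hD.tendsto_CLPn hK hpos) hC

omit hD hK hpos in
-- After interchanging the sums, the double weight depends on observation j only through its
-- rescaled position, since (x_j - x_i)/h is a difference of rescaled positions.
lemma weightLPbc_eq {n : ℕ} {h : ℝ} {X : ℕ → ℝ} (hh : 0 < h) (j : ℕ) :
    weightLPbc K p n h X j t₀ = convHat K p n h X t₀ ((X j - t₀) / h) -
      ∑ k, coeffHat K p n h X t₀ k * monoKernel K k ((X j - t₀) / h) := by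
  rw [weightLPbc, weight_eq_sum j t₀]
  congr 1
  simp only [convHat, empMean, mul_one]
  rw [← Finset.mul_sum, Finset.sum_comm]
  congr 1
  refine Finset.sum_congr rfl fun i _ => ?_
  rw [weight_eq_sum i t₀, weight_eq_sum j (X i), Finset.mul_sum]
  refine Finset.sum_congr rfl fun k _ => ?_
  rw [div_mul_cancel₀ _ hh.ne', add_sub_cancel, ← sub_div, sub_sub_sub_cancel_right, mul_assoc]

/-! ### Residuals -/

/-- The leverage as a function of the rescaled position. -/
def leverageHat (K : ℝ → ℝ) (p n : ℕ) (h : ℝ) (X : ℕ → ℝ) (t₀ u : ℝ) : ℝ :=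
  ∑ j : Fin (p + 2), ∑ k : Fin (p + 2),
    ((n * h)⁻¹ * (gramMatrix K (p + 1) n h X t₀)⁻¹ j k) * monoKernel K ((j : ℕ) + k) u

omit hD hK hpos in
lemma leverage_eq {n : ℕ} {h : ℝ} {X : ℕ → ℝ} (i : ℕ) :
    leverage K p n h X t₀ i = leverageHat K p n h X t₀ ((X i - t₀) / h) := by
  simp only [leverage, leverageHat, Matrix.mulVec, dotProduct, rVec, Finset.mul_sum, Finset.sum_mul,
    monoKernel]
  refine Finset.sum_congr rfl fun j _ => Finset.sum_congr rfl fun k _ => ?_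
  rw [pow_add]
  ring

/-- The inverse Gram matrix converges and the monomial kernels are bounded, so the prefactor (nh)⁻¹
decides. -/
lemma LocalLimits.tendstoUniformlyOn_leverageHat (S : Set ℝ) :
    TendstoUniformlyOn (fun i u => leverageHat K p (n i) (h i) (X i) t₀ u) (fun _ => 0) l S := by
  have h0 : (fun _ : ℝ => (0 : ℝ)) = fun u => ∑ j : Fin (p + 2), ∑ k : Fin (p + 2),
      0 * monoKernel K ((j : ℕ) + k) u := by simp
  rw [h0]
  refine tendstoUniformlyOn_sum _ fun j _ => tendstoUniformlyOn_sum _ fun k _ => ?_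
  obtain ⟨B, hB⟩ := (isKernelLike_monoKernel hK ((j : ℕ) + k)).bdd
  refine tendstoUniformlyOn_mul_of_bdd (f := fun _ => 0) (tendstoUniformlyOn_of_tendsto ?_ S) ?_
    ⟨0, fun _ _ => by simp⟩ ⟨B, fun u _ => hB u⟩
  · have h1 := tendsto_pi_nhds.1
      (tendsto_pi_nhds.1 (hD.tendsto_gramMatrix_inv_center hK hpos (p + 1)) j) k
    simpa using (tendsto_inv_atTop_zero.comp hD.tendsto_nh).mul h1
  · rw [Metric.tendstoUniformlyOn_iff]
    exact fun ε hε => Eventually.of_forall fun i s _ => by rwa [dist_self]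

/-- The residual correction as a function of the rescaled position. -/
def hcFactorHat (t : HCType) (K : ℝ → ℝ) (p n : ℕ) (h : ℝ) (X : ℕ → ℝ) (t₀ u : ℝ) : ℝ :=
  match t with
  | .HC0 => 1
  | .HC1 => (n : ℝ) / ((n : ℝ) - ((p : ℝ) + 2))
  | .HC2 => (1 - leverageHat K p n h X t₀ u)⁻¹
  | .HC3 => ((1 - leverageHat K p n h X t₀ u) ^ 2)⁻¹

omit hD hK hpos in
lemma hcFactor_eq (t : HCType) {n : ℕ} {h : ℝ} {X : ℕ → ℝ} (i : ℕ) :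
    hcFactor t K p n h X t₀ i = hcFactorHat t K p n h X t₀ ((X i - t₀) / h) := by
  cases t <;> simp only [hcFactor, hcFactorHat, leverage_eq]

/-- The squared square root is kept because a correction factor can be negative at a finite index;
continuity at the limiting value 1 is all that is needed. -/
lemma LocalLimits.tendstoUniformlyOn_hcFactorHat (t : HCType) (S : Set ℝ) :
    TendstoUniformlyOn (fun i u => Real.sqrt (hcFactorHat t K p (n i) (h i) (X i) t₀ u) ^ 2)
      (fun _ => 1) l S := by
  have hl := hD.tendstoUniformlyOn_leverageHat (p := p) hK hpos S
  cases t with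
  | HC0 =>
    simp only [hcFactorHat, Real.sqrt_one, one_pow]
    exact tendstoUniformlyOn_of_tendsto tendsto_const_nhds S
  | HC1 =>
    simp only [hcFactorHat]
    refine tendstoUniformlyOn_of_tendsto ?_ S
    have h1 : Tendsto (fun m : ℕ => (m : ℝ) / ((m : ℝ) - ((p : ℝ) + 2))) atTop (𝓝 1) := by
      have h2 := tendsto_natCast_div_add_atTop (-((p : ℝ) + 2))
      simpa only [sub_eq_add_neg] using h2
    have h3 := ((h1.comp hD.tendsto_n).sqrt).pow 2
    simpa [Function.comp_def] using h3
  | HC2 =>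
    have := tendstoUniformlyOn_comp_const (g := fun x => Real.sqrt (1 - x)⁻¹ ^ 2) hl
      (((Real.continuous_sqrt.continuousAt).comp
        ((continuousAt_const.sub continuousAt_id).inv₀ (by simp))).pow 2)
    simpa [hcFactorHat] using this
  | HC3 =>
    have := tendstoUniformlyOn_comp_const (g := fun x => Real.sqrt ((1 - x) ^ 2)⁻¹ ^ 2) hl
      (((Real.continuous_sqrt.continuousAt).comp
        (((continuousAt_const.sub continuousAt_id).pow 2).inv₀ (by simp))).pow 2)
    simpa [hcFactorHat] using this

/-- The fit of order `p + 1` as a function of the rescaled position. -/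
def fitHat (K : ℝ → ℝ) (p n : ℕ) (h : ℝ) (X Y : ℕ → ℝ) (t₀ u : ℝ) : ℝ :=
  ∑ j : Fin (p + 2), ((gramMatrix K (p + 1) n h X t₀)⁻¹.mulVec fun k : Fin (p + 2) =>
    empMean n h (fun i => (X i - t₀) / h) Y (monoKernel K k)) j * u ^ (j : ℕ)

omit hD hK hpos in
lemma bcResidual_eq {n : ℕ} {h : ℝ} {X Y : ℕ → ℝ} (hh : 0 < h) (i : ℕ) :
    bcResidual K p n h X Y t₀ i = Y i - fitHat K p n h X Y t₀ ((X i - t₀) / h) := by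
  rw [bcResidual, fitHat]
  congr 1
  refine Finset.sum_congr rfl fun j _ => ?_
  have h1 : (fun k : Fin (p + 2) => ((n : ℝ) * h)⁻¹ * ∑ i ∈ Finset.range n,
      K ((X i - t₀) / h) * rVec (p + 1) ((X i - t₀) / h) k * Y i) =
      fun k : Fin (p + 2) => empMean n h (fun i => (X i - t₀) / h) Y (monoKernel K k) := by
    funext k
    simp only [empMean, monoKernel, rVec, mul_comm (K _)]
  rw [betaHat, h1, rVec, div_pow]
  field_simp

lemma LocalLimits.tendstoUniformlyOn_fitHat (R : ℝ) :
    TendstoUniformlyOn (fun i u => fitHat K p (n i) (h i) (X i) (Y i) t₀ u) (fun _ => g₀) l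
      (Icc (-R) R) := by
  have hdet : (c • kernelMoment K (p + 1) A).det ≠ 0 := by
    have := kernelMoment_shift_det_ne_zero hK hpos hD.isClosed_A.measurableSet hD.add_mem (p + 1)
      hD.zero_mem
    rw [shiftSet_zero] at this
    rw [Matrix.det_smul]
    exact mul_ne_zero (pow_ne_zero _ hD.c_pos.ne') this
  -- The limiting right-hand side is g₀ times the zeroth column of the limiting Gram matrix. Solving
  -- the normal equations therefore gives the constant polynomial g₀.
  have hv : Tendsto (fun i => fun k : Fin (p + 2) =>
      empMean (n i) (h i) (fun j => (X i j - t₀) / h i) (Y i) (monoKernel K k)) l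
      (𝓝 ((c • kernelMoment K (p + 1) A).mulVec (Pi.single 0 g₀))) := by
    refine tendsto_pi_nhds.2 fun k => ?_
    have h1 := hD.mom_one _ (isKernelLike_monoKernel hK k).isTest
    convert h1 using 2
    · rfl
    simp [Matrix.mulVec_single, kernelMoment, monoKernel]
    ring
  have hb : Tendsto (fun i => (gramMatrix K (p + 1) (n i) (h i) (X i) t₀)⁻¹.mulVec fun k : Fin (p + 2) =>
      empMean (n i) (h i) (fun j => (X i j - t₀) / h i) (Y i) (monoKernel K k)) l
      (𝓝 (Pi.single 0 g₀)) := by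
    have h1 : Continuous fun q : Matrix (Fin (p + 2)) (Fin (p + 2)) ℝ × (Fin (p + 2) → ℝ) =>
        q.1.mulVec q.2 := continuous_fst.matrix_mulVec continuous_snd
    have h2 := (h1.tendsto _).comp
      ((hD.tendsto_gramMatrix_inv_center hK hpos (p + 1)).prodMk_nhds hv)
    rwa [Matrix.mulVec_mulVec, Matrix.nonsing_inv_mul _ (isUnit_iff_ne_zero.2 hdet),
      Matrix.one_mulVec] at h2
  have h0 : (fun _ : ℝ => g₀) = fun u => ∑ j : Fin (p + 2),
      (Pi.single 0 g₀ : Fin (p + 2) → ℝ) j * u ^ (j : ℕ) := by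
    funext u
    rw [Finset.sum_eq_single 0]
    · simp
    · intro j _ hj; simp [hj]
    · simp
  rw [h0]
  refine tendstoUniformlyOn_sum _ fun j _ => ?_
  refine tendstoUniformlyOn_mul_of_bdd
    (tendstoUniformlyOn_of_tendsto (tendsto_pi_nhds.1 hb j) _) ?_ ⟨_, fun _ _ => le_rfl⟩
    ⟨R ^ (j : ℕ), fun u hu => ?_⟩
  · rw [Metric.tendstoUniformlyOn_iff]
    exact fun ε hε => Eventually.of_forall fun i s _ => by rwa [dist_self]
  · rw [abs_pow]
    exact pow_le_pow_left₀ (abs_nonneg _) (abs_le.2 hu) _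

/-! ### The variance estimator -/

/-- The limiting weight function with scaling factor `q`. -/
def wLimit (K : ℝ → ℝ) (p : ℕ) (A : Set ℝ) (q u : ℝ) : ℝ :=
  eqKernel K p (shiftSet A 0) u - q * (convOn K p A u - eqKernel K p (shiftSet A 0) u)

omit hD in
lemma isTest_wLimit (hA : IsClosed A) (hadd : ∀ s ∈ A, ∀ u, 0 ≤ u → s + u ∈ A) (q : ℝ) :
    IsTest (wLimit K p A q) :=
  (isTest_eqKernel hK p _).sub
    (((isTest_convOn hK hpos hA hadd p).sub (isTest_eqKernel hK p _)).const_mul q)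

/-- With a random but convergent scaling factor, both estimators are instances. The squared residual
is expanded as Y² - 2 Y·fit + fit², so that the fit and the residual correction join the integrand
and only Y², Y and 1 remain as weights. -/
theorem LocalLimits.tendsto_variance (t : HCType) {q : ι → ℝ} {q₀ : ℝ} (hq : Tendsto q l (𝓝 q₀)) :
    Tendsto (fun i => (n i * h i)⁻¹ * ∑ j ∈ Finset.range (n i),
      (weight K p (n i) (h i) (X i) j t₀ - q i * weightLPbc K p (n i) (h i) (X i) j t₀) ^ 2 *
        hcResidual t K p (n i) (h i) (X i) (Y i) t₀ j ^ 2) l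
      (𝓝 ((v₀ - g₀ ^ 2) / c * ∫ u in A, wLimit K p A q₀ u ^ 2)) := by
  set w : ι → ℝ → ℝ := fun i u => ∑ k, coeffHat K p (n i) (h i) (X i) t₀ k * monoKernel K k u with hw
  set F : ι → ℝ → ℝ := fun i u => w i u - q i * (convHat K p (n i) (h i) (X i) t₀ u - w i u) with hF
  set G : ℝ → ℝ := fun u => c⁻¹ * wLimit K p A q₀ u with hG
  have hGt : IsTest G := (isTest_wLimit hK hpos hD.isClosed_A hD.add_mem q₀).const_mul _
  have hF0 : ∀ i u, 2 < |u| → F i u = 0 := fun i u hu => by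
    simp only [hF, hw]
    rw [convHat_eq_zero hK hu.le, sum_coeffHat_mul_monoKernel_eq_zero hK (by linarith)]
    ring
  have hG0 : ∀ u, 2 < |u| → G u = 0 := fun u hu => by
    simp only [hG, wLimit]
    rw [convOn_eq_zero hK p A hu.le, eqKernel_eq_zero hK p _ (by linarith)]
    ring
  have hwt := (isTest_eqKernel hK p (shiftSet A 0)).const_mul c⁻¹
  have hct := (isTest_convOn hK hpos hD.isClosed_A hD.add_mem p).const_mul c⁻¹
  have hwu := hD.tendstoUniformlyOn_weight (p := p) hK hpos
  have hFG : TendstoUniformlyOn F G l A := by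
    have h1 := hwu.sub (tendstoUniformlyOn_mul_of_bdd (tendstoUniformlyOn_of_tendsto hq A)
      ((hD.tendstoUniformlyOn_convHat (p := p) hK hpos).sub hwu) ⟨|q₀|, fun _ _ => le_rfl⟩
      ((hct.sub hwt).bdd.imp fun B hB u _ => hB u))
    refine h1.congr_right fun u _ => ?_
    simp only [hG, wLimit, Pi.sub_apply]
    ring
  have hb : ∀ {φ : ℝ → ℝ}, IsTest φ → ∃ B, ∀ u ∈ A ∩ Icc (-2) 2, |φ u| ≤ B := fun hφ =>
    hφ.bdd.imp fun B hB u _ => hB u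
  have hbc : ∀ a : ℝ, ∃ B, ∀ u ∈ A ∩ Icc (-2) 2, |(fun _ : ℝ => a) u| ≤ B := fun a =>
    ⟨|a|, fun _ _ => le_rfl⟩
  have hFG' := hFG.mono (inter_subset_left (t := Icc (-2 : ℝ) 2))
  have hfac := hD.tendstoUniformlyOn_hcFactorHat (p := p) hK hpos t (A ∩ Icc (-2) 2)
  have hfit := (hD.tendstoUniformlyOn_fitHat (p := p) hK hpos 2).mono
    (inter_subset_right (s := A))
  have hu2 := tendstoUniformlyOn_mul_of_bdd
    (tendstoUniformlyOn_mul_of_bdd hFG' hFG' (hb hGt) (hb hGt)) hfac (hb (hGt.mul hGt)) (hbc 1)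
  have hGG1 : IsTest fun u => G u * G u * 1 := by simpa using hGt.mul hGt
  have hu1 := tendstoUniformlyOn_mul_of_bdd hu2 hfit (hb hGG1) (hbc g₀)
  have hGGg : IsTest fun u => G u * G u * 1 * g₀ := by simpa only [mul_comm] using hGG1.const_mul g₀
  have hu0 := tendstoUniformlyOn_mul_of_bdd hu1 hfit (hb hGGg) (hbc g₀)
  have hGGgg : IsTest fun u => G u * G u * 1 * g₀ * g₀ := by
    simpa only [mul_comm] using hGGg.const_mul g₀
  -- The weight 1 + Y² dominates 1, |Y| and Y² at once, and its own empirical means converge.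
  have hdom : EmpTendsto l n h (scaledObs h X t₀) (fun i j => 1 + Y i j ^ 2) A (c + c * v₀) := by
    intro φ hφ
    have := (hD.mom_zero φ hφ).add (hD.mom_two φ hφ)
    simp only [empMean, ← mul_add, ← Finset.sum_add_distrib, ← add_mul] at this ⊢
    exact this
  have E2 := hD.mom_two.tendsto_of_tendstoUniformlyOn hdom
    (fun i j => by rw [abs_of_nonneg (sq_nonneg _)]; linarith) hD.h_pos hD.mem_A (R := 2)
    (F := fun i u => F i u * F i u * Real.sqrt (hcFactorHat t K p (n i) (h i) (X i) t₀ u) ^ 2)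
    (fun i u hu => by simp only [hF0 i u hu, zero_mul]) hGG1
    (fun u hu => by simp only [hG0 u hu, zero_mul])
    (tendstoUniformlyOn_of_inter_Icc hu2 (fun i u hu => by simp only [hF0 i u hu, zero_mul])
      (fun u hu => by simp only [hG0 u hu, zero_mul]))
  have E1 := hD.mom_one.tendsto_of_tendstoUniformlyOn hdom
    (fun i j => by
      rw [abs_le]
      constructor <;> nlinarith [sq_nonneg (Y i j - 1), sq_nonneg (Y i j + 1)])
    hD.h_pos hD.mem_A (R := 2)
    (F := fun i u => F i u * F i u * Real.sqrt (hcFactorHat t K p (n i) (h i) (X i) t₀ u) ^ 2 *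
      fitHat K p (n i) (h i) (X i) (Y i) t₀ u)
    (fun i u hu => by simp only [hF0 i u hu, zero_mul]) hGGg
    (fun u hu => by simp only [hG0 u hu, zero_mul])
    (tendstoUniformlyOn_of_inter_Icc hu1 (fun i u hu => by simp only [hF0 i u hu, zero_mul])
      (fun u hu => by simp only [hG0 u hu, zero_mul]))
  have E0 := hD.mom_zero.tendsto_of_tendstoUniformlyOn hdom
    (fun i j => by
      rw [abs_one]
      linarith [sq_nonneg (Y i j)])
    hD.h_pos hD.mem_A (R := 2)
    (F := fun i u => F i u * F i u * Real.sqrt (hcFactorHat t K p (n i) (h i) (X i) t₀ u) ^ 2 *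
      fitHat K p (n i) (h i) (X i) (Y i) t₀ u * fitHat K p (n i) (h i) (X i) (Y i) t₀ u)
    (fun i u hu => by simp only [hF0 i u hu, zero_mul]) hGGgg
    (fun u hu => by simp only [hG0 u hu, zero_mul])
    (tendstoUniformlyOn_of_inter_Icc hu0 (fun i u hu => by simp only [hF0 i u hu, zero_mul])
      (fun u hu => by simp only [hG0 u hu, zero_mul]))
  have E := (E2.sub (E1.const_mul 2)).add E0
  convert E using 2
  · rename_i i
    simp only [empMean, scaledObs, Finset.mul_sum]
    rw [← Finset.sum_sub_distrib, ← Finset.sum_add_distrib]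
    refine Finset.sum_congr rfl fun j _ => ?_
    rw [hcResidual, bcResidual_eq (hD.h_pos i), hcFactor_eq, weightLPbc_eq (hD.h_pos i),
      weight_eq_sum j t₀]
    simp only [hF, hw]
    ring
  · have hne := hD.c_pos.ne'
    -- Each integral carries c⁻² from G², against one factor c from the density. The combination v₀
    -- - 2 g₀² + g₀² is the variance.
    have e1 : ∀ a : ℝ, ∫ u in A, G u * G u * a = a * ((c⁻¹) ^ 2 * ∫ u in A, wLimit K p A q₀ u ^ 2) := by
      intro a
      rw [← integral_const_mul, ← integral_const_mul]
      congr 1; funext u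
      simp only [hG]; ring
    simp only [mul_assoc _ _ g₀, e1]
    field_simp
    ring

end Limits

/-! ### Convergence in probability as convergence along a filter -/

section ProbFilter

variable {Ω : Type*} [MeasurableSpace Ω]

/-- The filter on `ℕ × Ω` of the sets whose `n`-th section has probability tending to one. -/
def probFilter (P : Measure Ω) : Filter (ℕ × Ω) where
  sets := {S | Tendsto (fun n => P {ω | (n, ω) ∉ S}) atTop (𝓝 0)}
  univ_sets := by simp
  sets_of_superset {S T} hS hST := by
    refine tendsto_of_tendsto_of_tendsto_of_le_of_le tendsto_const_nhds hS (fun _ => zero_le) ?_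
    exact fun n => measure_mono fun ω hω h => hω (hST h)
  inter_sets {S T} hS hT := by
    have h := Tendsto.add (mem_ofPred.1 hS) (mem_ofPred.1 hT)
    rw [add_zero] at h
    refine tendsto_of_tendsto_of_tendsto_of_le_of_le tendsto_const_nhds h (fun _ => zero_le) ?_
    intro n
    refine le_trans (measure_mono fun ω hω => ?_) (measure_union_le _ _)
    by_contra hc
    simp only [mem_union, mem_ofPred_eq, not_or, not_not] at hc
    exact hω ⟨hc.1, hc.2⟩

variable {P : Measure Ω}

lemma mem_probFilter {S : Set (ℕ × Ω)} :
    S ∈ probFilter P ↔ Tendsto (fun n => P {ω | (n, ω) ∉ S}) atTop (𝓝 0) := Iff.rfl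

lemma tendstoInMeasure_of_tendsto_probFilter {F : ℕ → Ω → ℝ} {c : ℝ}
    (hF : Tendsto (fun q : ℕ × Ω => F q.1 q.2) (probFilter P) (𝓝 c)) :
    TendstoInMeasure P F atTop (fun _ => c) := by
  intro ε hε
  -- The threshold in `TendstoInMeasure` is an extended nonnegative number, possibly infinite;
  -- capping it at 1 makes it a real radius.
  have hε' : 0 < (min ε 1).toReal :=
    ENNReal.toReal_pos (by simp [hε.ne']) (ne_top_of_le_ne_top ENNReal.one_ne_top (min_le_right _ _))
  have h1 := mem_probFilter.1 (Metric.tendsto_nhds.1 hF _ hε')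
  refine tendsto_of_tendsto_of_tendsto_of_le_of_le tendsto_const_nhds h1 (fun _ => zero_le) ?_
  refine fun n => measure_mono fun ω hω hlt => ?_
  simp only [mem_ofPred_eq] at hω hlt
  have h2 : edist (F n ω) c < min ε 1 := by
    rw [edist_dist]
    exact (ENNReal.ofReal_lt_iff_lt_toReal dist_nonneg
      (ne_top_of_le_ne_top ENNReal.one_ne_top (min_le_right _ _))).2 hlt
  exact absurd (h2.trans_le (min_le_left _ _)) (not_lt.2 hω)

lemma eventually_probFilter_of_ae {p : ℕ × Ω → Prop} (hp : ∀ᶠ n in atTop, ∀ᵐ ω ∂P, p (n, ω)) :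
    ∀ᶠ q in probFilter P, p q := by
  refine mem_probFilter.2 (tendsto_const_nhds.congr' ?_)
  filter_upwards [hp] with n hn
  exact (measure_eq_zero_iff_ae_notMem.2 (hn.mono fun ω h => not_not.2 h)).symm

lemma tendsto_fst_probFilter {α : Type*} {F : ℕ → α} {l : Filter α} (hF : Tendsto F atTop l) :
    Tendsto (fun q : ℕ × Ω => F q.1) (probFilter P) l := by
  intro S hS
  exact eventually_probFilter_of_ae ((hF.eventually_mem hS).mono fun n hn => Eventually.of_forall fun _ => hn)

/-- A weak law of large numbers for row-wise i.i.d. triangular arrays of local averages. -/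
lemma tendsto_probFilter_average [IsProbabilityMeasure P] {Z : ℕ → ℕ → Ω → ℝ} {h : ℕ → ℝ} {μ C : ℝ}
    (hh : ∀ n, 0 < h n) (hnh : Tendsto (fun n : ℕ => (n : ℝ) * h n) atTop atTop)
    (hind : ∀ n i j, i ≠ j → IndepFun (Z n i) (Z n j) P)
    (hid : ∀ n i, IdentDistrib (Z n i) (Z n 0) P P)
    (hL2 : ∀ᶠ n in atTop, MemLp (Z n 0) 2 P)
    (hsq : ∀ᶠ n in atTop, ∫ ω, Z n 0 ω ^ 2 ∂P ≤ C * h n)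
    (hmean : Tendsto (fun n => (h n)⁻¹ * ∫ ω, Z n 0 ω ∂P) atTop (𝓝 μ)) :
    Tendsto (fun q : ℕ × Ω => ((q.1 : ℝ) * h q.1)⁻¹ * ∑ i ∈ Finset.range q.1, Z q.1 i q.2)
      (probFilter P) (𝓝 μ) := by
  rw [Metric.tendsto_nhds]
  intro ε hε
  rw [Filter.Eventually, mem_probFilter]
  -- The Chebyshev bound: variance at most n|C|h against the squared deviation (ε/2 · nh)². The
  -- other ε/2 is spent on the distance of the mean from its limit.
  have hlim : Tendsto (fun n : ℕ => ENNReal.ofReal (|C| / (ε / 2) ^ 2 * ((n : ℝ) * h n)⁻¹)) atTop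
      (𝓝 0) := by
    have := (tendsto_inv_atTop_zero.comp hnh).const_mul (|C| / (ε / 2) ^ 2)
    rw [mul_zero] at this
    simpa [Function.comp_def] using ENNReal.tendsto_ofReal this
  refine tendsto_of_tendsto_of_tendsto_of_le_of_le' tendsto_const_nhds hlim
    (Eventually.of_forall fun _ => zero_le) ?_
  filter_upwards [hL2, hsq, Metric.tendsto_nhds.1 hmean (ε / 2) (by positivity),
    eventually_gt_atTop 0] with n h2 hs hm hn
  have hn' : (0 : ℝ) < n := Nat.cast_pos.2 hn
  have hpos : 0 < (n : ℝ) * h n := mul_pos hn' (hh n)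
  have hmem : ∀ i ∈ Finset.range n, MemLp (Z n i) 2 P := fun i _ => (hid n i).symm.memLp_snd h2
  have hmean' : ∫ ω, (∑ i ∈ Finset.range n, Z n i) ω ∂P = n * ∫ ω, Z n 0 ω ∂P := by
    simp only [Finset.sum_apply]
    rw [integral_finsetSum _ fun i hi => (hmem i hi).integrable one_le_two]
    simp only [(hid n _).integral_eq, Finset.sum_const, Finset.card_range, nsmul_eq_mul]
  have hvar : Var[∑ i ∈ Finset.range n, Z n i; P] ≤ n * (|C| * h n) := by
    rw [IndepFun.variance_sum hmem fun i _ j _ hij => hind n i j hij]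
    have : ∀ i ∈ Finset.range n, Var[Z n i; P] ≤ |C| * h n := fun i hi => by
      rw [(hid n i).variance_eq]
      refine (variance_le_expectation_sq h2.aestronglyMeasurable).trans (hs.trans ?_)
      exact mul_le_mul_of_nonneg_right (le_abs_self C) (hh n).le
    simpa using Finset.sum_le_sum this
  have hch := meas_ge_le_variance_div_sq (memLp_finsetSum' _ hmem)
    (c := ε / 2 * ((n : ℝ) * h n)) (by positivity)
  refine le_trans (measure_mono fun ω hω => ?_) (hch.trans (ENNReal.ofReal_le_ofReal ?_))
  · simp only [mem_ofPred_eq, not_lt] at hω ⊢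
    rw [hmean', Finset.sum_apply]
    rw [Real.dist_eq] at hω hm
    have h3 := abs_sub_le (((n : ℝ) * h n)⁻¹ * ∑ i ∈ Finset.range n, Z n i ω)
      ((h n)⁻¹ * ∫ ω, Z n 0 ω ∂P) μ
    have h4 : ε / 2 ≤ |((n : ℝ) * h n)⁻¹ * ∑ i ∈ Finset.range n, Z n i ω
        - (h n)⁻¹ * ∫ ω, Z n 0 ω ∂P| := by linarith
    have h5 : ∑ i ∈ Finset.range n, Z n i ω - n * ∫ ω, Z n 0 ω ∂P = ((n : ℝ) * h n) *
        (((n : ℝ) * h n)⁻¹ * ∑ i ∈ Finset.range n, Z n i ω - (h n)⁻¹ * ∫ ω, Z n 0 ω ∂P) := by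
      have := (hh n).ne'
      field_simp
    rw [h5, abs_mul, abs_of_pos hpos, mul_comm]
    gcongr
  · calc _ ≤ n * (|C| * h n) / (ε / 2 * ((n : ℝ) * h n)) ^ 2 := by gcongr
      _ = _ := by
        have := (hh n).ne'
        field_simp

end ProbFilter

/-! ### Local moments -/

/-- Near `t₀`, the set `S` is `t₀ + A`, where `A` is a closed cone that contains the positive
half-line. -/
structure LocalShape (S : Set ℝ) (t₀ : ℝ) (A : Set ℝ) : Prop where
  isClosed_A : IsClosed A
  zero_mem : (0 : ℝ) ∈ A
  add_mem : ∀ s ∈ A, ∀ u, 0 ≤ u → s + u ∈ A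
  mul_mem_iff : ∀ r > 0, ∀ u, r * u ∈ A ↔ u ∈ A
  mem_iff : ∃ δ > 0, ∀ t, |t - t₀| < δ → (t ∈ S ↔ t - t₀ ∈ A)

lemma LocalShape.mem_center {S A : Set ℝ} {t₀ : ℝ} (hA : LocalShape S t₀ A) : t₀ ∈ S := by
  obtain ⟨δ, hδ, H⟩ := hA.mem_iff
  exact (H t₀ (by simpa using hδ)).2 (by simpa using hA.zero_mem)

lemma LocalShape.interior {S : Set ℝ} {t₀ : ℝ} (h : IsInteriorPoint S t₀) :
    LocalShape S t₀ univ := by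
  refine ⟨isClosed_univ, trivial, fun _ _ _ _ => trivial, fun _ _ _ => by simp, ?_⟩
  obtain ⟨δ, hδ, H⟩ := Metric.mem_nhds_iff.1 (mem_interior_iff_mem_nhds.1 h)
  exact ⟨δ, hδ, fun t ht => by simpa using H (by rwa [Metric.mem_ball, Real.dist_eq])⟩

lemma LocalShape.leftBoundary {S : Set ℝ} {t₀ : ℝ} (h : IsLeftBoundaryPoint S t₀) :
    LocalShape S t₀ (Ici 0) := by
  obtain ⟨δ, hδ, H⟩ := h
  refine ⟨isClosed_Ici, self_mem_Ici, fun s hs u hu => add_nonneg hs hu,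
    fun r hr u => by simp [hr], δ, hδ, fun t ht => ?_⟩
  have ht' := abs_lt.1 ht
  have h1 : t ∈ Ioo (t₀ - δ) (t₀ + δ) := ⟨by linarith, by linarith⟩
  have h2 : t ∈ S ↔ t ∈ Ico t₀ (t₀ + δ) := by
    rw [← H]; exact ⟨fun h => ⟨h, h1⟩, fun h => h.1⟩
  rw [h2, mem_Ico, mem_Ici, sub_nonneg]
  exact ⟨fun h => h.1, fun h => ⟨h, by linarith⟩⟩

lemma inv_mul_integral_comp_scale (φ H : ℝ → ℝ) (t₀ : ℝ) {h : ℝ} (hh : 0 < h) :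
    h⁻¹ * ∫ t, φ ((t - t₀) / h) * H t = ∫ u, φ u * H (t₀ + h * u) := by
  have h1 := Measure.integral_comp_mul_left (fun v => φ (v / h) * H (t₀ + v)) h
  have h2 := integral_sub_right_eq_self (μ := (volume : Measure ℝ))
    (fun v => φ (v / h) * H (t₀ + v)) t₀
  simp only [add_sub_cancel] at h2
  rw [h2, ← abs_of_pos (inv_pos.2 hh), ← smul_eq_mul, ← h1]
  congr 1; funext u
  rw [mul_div_cancel_left₀ _ hh.ne']

section LocalMean

variable {ν : Measure ℝ} {f : ℝ → ℝ} {N A : Set ℝ} {t₀ : ℝ} {h : ℕ → ℝ}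

/-- Substituting t = t₀ + h u turns the local mean into an integral of φ against a rescaled
function, and dominated convergence applies. The conditional moment m' is determined only almost
everywhere, hence its continuous version m. -/
lemma tendsto_local_mean (hf : Measurable f) (hf0 : ∀ t, 0 ≤ f t)
    (hν : ν = volume.withDensity fun t => ENNReal.ofReal (f t))
    (hfc : ContinuousOn f ν.support) (hN : IsOpen N) (ht₀ : t₀ ∈ N)
    (hA : LocalShape ν.support t₀ A) (hh : ∀ n, 0 < h n) (hlim : Tendsto h atTop (𝓝 0))
    {m m' : ℝ → ℝ} (hmc : ContinuousOn m (N ∩ ν.support)) (hmm' : ∀ᵐ t ∂ν, t ∈ N → m' t = m t)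
    {φ : ℝ → ℝ} (hφ : IsTest φ) :
    Tendsto (fun n => (h n)⁻¹ * ∫ t, φ ((t - t₀) / h n) * m' t ∂ν) atTop
      (𝓝 (f t₀ * m t₀ * ∫ u in A, φ u)) := by
  classical
  obtain ⟨B, hB⟩ := hφ.bdd
  obtain ⟨R, hR⟩ := hφ.supp
  have hB0 : 0 ≤ B := (abs_nonneg _).trans (hB 0)
  set S := ν.support with hS
  have hSm : MeasurableSet S := Measure.isClosed_support.measurableSet
  have ht₀S : t₀ ∈ S := hA.mem_center
  -- Cutting off outside N ∩ S is harmless, since ν is carried by S and φ is supported in N after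
  -- rescaling. It is needed because continuity is available only on that set.
  set H : ℝ → ℝ := (N ∩ S).indicator fun t => m t * f t with hH
  have hHm : Measurable H := by
    have hc : ContinuousOn (fun t => m t * f t) (N ∩ S) :=
      hmc.mul (hfc.mono inter_subset_right)
    have := ContinuousOn.measurable_piecewise (g := fun _ => (0 : ℝ)) hc continuousOn_const
      (hN.measurableSet.inter hSm)
    convert this using 1
    funext u
    by_cases hu : u ∈ N ∩ S
    · rw [piecewise_eq_of_mem _ _ _ hu, hH, indicator_of_mem hu]
    · rw [piecewise_eq_of_notMem _ _ _ hu, hH, indicator_of_notMem hu]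
  have hRh : Tendsto (fun n => (|R| + 1) * h n) atTop (𝓝 0) := by
    simpa using hlim.const_mul (|R| + 1)
  have hnear : ∀ δ > 0, ∀ᶠ n in atTop, ∀ t, |(t - t₀) / h n| ≤ R → |t - t₀| < δ := by
    intro δ hδ
    filter_upwards [hRh.eventually (gt_mem_nhds hδ)] with n hn t ht
    rw [abs_div, abs_of_pos (hh n), div_le_iff₀ (hh n)] at ht
    have := mul_le_mul_of_nonneg_right (le_abs_self R) (hh n).le
    linarith [hh n]
  obtain ⟨δN, hδN, hNball⟩ := Metric.isOpen_iff.1 hN t₀ ht₀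
  have hae : ∀ᵐ t ∂ν, t ∈ N → m' t = (N ∩ S).indicator m t := by
    filter_upwards [hmm', Measure.support_mem_ae (μ := ν)] with t h1 h2 h3
    rw [h1 h3, indicator_of_mem (show t ∈ N ∩ S from ⟨h3, h2⟩)]
  have hrew : ∀ᶠ n in atTop, (h n)⁻¹ * ∫ t, φ ((t - t₀) / h n) * m' t ∂ν
      = ∫ u, φ u * H (t₀ + h n * u) := by
    filter_upwards [hnear δN hδN] with n hn
    rw [← inv_mul_integral_comp_scale φ H t₀ (hh n)]
    congr 1
    have h1 : ∫ t, φ ((t - t₀) / h n) * m' t ∂ν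
        = ∫ t, φ ((t - t₀) / h n) * (N ∩ S).indicator m t ∂ν := by
      refine integral_congr_ae ?_
      filter_upwards [hae] with t ht
      by_cases hz : |(t - t₀) / h n| ≤ R
      · rw [ht (hNball (by rw [Metric.mem_ball, Real.dist_eq]; exact hn t hz))]
      · rw [hR _ (not_le.1 hz), zero_mul, zero_mul]
    rw [h1, hν, integral_withDensity_eq_integral_toReal_smul hf.ennreal_ofReal
      (Eventually.of_forall fun _ => ENNReal.ofReal_lt_top)]
    congr 1; funext t
    rw [ENNReal.toReal_ofReal (hf0 t), smul_eq_mul, hH]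
    by_cases hu : t ∈ N ∩ S
    · rw [indicator_of_mem hu, indicator_of_mem hu]; ring
    · rw [indicator_of_notMem hu, indicator_of_notMem hu]; ring
  refine Tendsto.congr' (hrew.mono fun n hn => hn.symm) ?_
  have hcw : ContinuousWithinAt (fun t => m t * f t) (N ∩ S) t₀ :=
    (hmc t₀ ⟨ht₀, ht₀S⟩).mul ((hfc t₀ ht₀S).mono inter_subset_right)
  obtain ⟨δc, hδc, hcb⟩ := Metric.continuousWithinAt_iff.1 hcw 1 one_pos
  have hHbound : ∀ t, |t - t₀| < δc → |H t| ≤ |m t₀ * f t₀| + 1 := by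
    intro t ht
    by_cases hu : t ∈ N ∩ S
    · rw [hH, indicator_of_mem hu]
      have h1 := hcb hu (by rwa [Real.dist_eq])
      rw [Real.dist_eq] at h1
      have h2 := abs_sub_abs_le_abs_sub (m t * f t) (m t₀ * f t₀)
      linarith
    · rw [hH, indicator_of_notMem hu, abs_zero]; positivity
  have hlimit : f t₀ * m t₀ * ∫ u in A, φ u = ∫ u, φ u * A.indicator (fun _ => m t₀ * f t₀) u := by
    rw [← integral_indicator hA.isClosed_A.measurableSet, ← integral_const_mul]
    congr 1; funext u
    by_cases hu : u ∈ A
    · rw [indicator_of_mem hu, indicator_of_mem hu]; ring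
    · rw [indicator_of_notMem hu, indicator_of_notMem hu]; ring
  rw [hlimit]
  refine tendsto_integral_filter_of_dominated_convergence (fun u => |φ u| * (|m t₀ * f t₀| + 1))
    (Eventually.of_forall fun n => (hφ.measurable.mul
      (hHm.comp (by fun_prop))).aestronglyMeasurable) ?_ (hφ.integrable.abs.mul_const _) ?_
  · filter_upwards [hnear δc hδc] with n hn
    refine Eventually.of_forall fun u => ?_
    rw [norm_mul]
    by_cases hz : |u| ≤ R
    · refine mul_le_mul_of_nonneg_left (hHbound _ (hn _ ?_)) (abs_nonneg _)
      rwa [add_sub_cancel_left, mul_div_cancel_left₀ _ (hh n).ne']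
    · rw [hR _ (not_le.1 hz)]; simp
  · refine Eventually.of_forall fun u => ?_
    refine tendsto_const_nhds.mul ?_
    -- For fixed u the points t₀ + h u approach t₀, and by the cone property they lie in the support
    -- exactly when u ∈ A. This is where the indicator of A enters the limit.
    obtain ⟨δ, hδ, hshape⟩ := hA.mem_iff
    have htend : Tendsto (fun n => t₀ + h n * u) atTop (𝓝 t₀) := by
      simpa using (hlim.mul_const u).const_add t₀
    have hev : ∀ᶠ n in atTop, (t₀ + h n * u ∈ N) ∧ (t₀ + h n * u ∈ S ↔ u ∈ A) := by
      filter_upwards [htend (hN.mem_nhds ht₀), htend (Metric.ball_mem_nhds t₀ hδ)] with n h1 h2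
      refine ⟨h1, ?_⟩
      rw [mem_preimage, Metric.mem_ball, Real.dist_eq] at h2
      rw [hshape _ h2, add_sub_cancel_left, hA.mul_mem_iff _ (hh n)]
    by_cases hu : u ∈ A
    · rw [indicator_of_mem hu]
      have h1 : Tendsto (fun n => t₀ + h n * u) atTop (𝓝[N ∩ S] t₀) :=
        tendsto_nhdsWithin_iff.2 ⟨htend, hev.mono fun n hn => ⟨hn.1, hn.2.2 hu⟩⟩
      refine (hcw.tendsto.comp h1).congr' ?_
      filter_upwards [hev] with n hn
      rw [hH, indicator_of_mem (show t₀ + h n * u ∈ N ∩ S from ⟨hn.1, hn.2.2 hu⟩)]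
      rfl
    · rw [indicator_of_notMem hu]
      refine tendsto_const_nhds.congr' ?_
      filter_upwards [hev] with n hn
      rw [hH, indicator_of_notMem fun h => hu (hn.2.1 h.2)]

end LocalMean

/-! ### Consequences of the bandwidth and moment assumptions -/

lemma KernelBandwidthAssumption.isKernelLike {K : ℝ → ℝ} {h : ℕ → ℝ} {κ : ℝ} {p : ℕ}
    (hK : KernelBandwidthAssumption K h κ p) : IsKernelLike K :=
  ⟨hK.K_zero, hK.K_lipschitz⟩

lemma KernelBandwidthAssumption.tendsto_h {K : ℝ → ℝ} {h : ℕ → ℝ} {κ : ℝ} {p : ℕ}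
    (hK : KernelBandwidthAssumption K h κ p) : Tendsto h atTop (𝓝 0) := by
  refine tendsto_of_tendsto_of_tendsto_of_le_of_le tendsto_const_nhds hK.h_lim
    (fun n => (hK.h_pos n).le) fun n => ?_
  have h1 : 0 ≤ ((n : ℝ) * h n)⁻¹ := inv_nonneg.2 (mul_nonneg n.cast_nonneg (hK.h_pos n).le)
  exact le_add_of_nonneg_right (mul_nonneg h1 (Real.log_natCast_nonneg n))

/-- Once log n ≥ 1, the inverse of nh is squeezed by the bandwidth condition; it is positive, so nh
itself diverges. -/
lemma KernelBandwidthAssumption.tendsto_nh {K : ℝ → ℝ} {h : ℕ → ℝ} {κ : ℝ} {p : ℕ}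
    (hK : KernelBandwidthAssumption K h κ p) :
    Tendsto (fun n : ℕ => (n : ℝ) * h n) atTop atTop := by
  have hpos : ∀ᶠ n : ℕ in atTop, 0 < ((n : ℝ) * h n)⁻¹ := by
    filter_upwards [eventually_gt_atTop 0] with n hn
    exact inv_pos.2 (mul_pos (Nat.cast_pos.2 hn) (hK.h_pos n))
  have h0 : Tendsto (fun n : ℕ => ((n : ℝ) * h n)⁻¹) atTop (𝓝 0) := by
    refine tendsto_of_tendsto_of_tendsto_of_le_of_le' tendsto_const_nhds hK.h_lim
      (hpos.mono fun n hn => hn.le) ?_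
    filter_upwards [hpos, (Real.tendsto_log_atTop.comp tendsto_natCast_atTop_atTop).eventually_ge_atTop 1]
      with n hn hl
    have h1 : 1 ≤ Real.log n := hl
    have h2 : ((n : ℝ) * h n)⁻¹ * 1 ≤ ((n : ℝ) * h n)⁻¹ * Real.log n := by gcongr
    linarith [(hK.h_pos n).le]
  have := (tendsto_nhdsWithin_iff.2 ⟨h0, hpos⟩ : Tendsto _ _ (𝓝[>] (0 : ℝ))).inv_tendsto_nhdsGT_zero
  simpa only [Pi.inv_def, inv_inv] using this

lemma pow_sq_le_one_add_pow_four (v : ℝ) {m : ℕ} (hm : m ≤ 2) : (v ^ m) ^ 2 ≤ 1 + v ^ 4 := by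
  interval_cases m
  · nlinarith [sq_nonneg (v ^ 2)]
  · nlinarith [sq_nonneg (v ^ 2 - 1), sq_nonneg (v ^ 2)]
  · nlinarith

lemma memLp_two_id_of_fourth_moment {κ : Measure ℝ} [IsProbabilityMeasure κ]
    (h4 : ∫⁻ v, ENNReal.ofReal (v ^ 4) ∂κ < ∞) : MemLp (fun v : ℝ => v) 2 κ := by
  have h0 : ∀ v : ℝ, 0 ≤ v ^ 4 := fun v => by positivity
  have hint : Integrable (fun v : ℝ => v ^ 4) κ :=
    ⟨(measurable_id.pow_const 4).aestronglyMeasurable,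
      (hasFiniteIntegral_iff_ofReal (Eventually.of_forall h0)).2 h4⟩
  rw [memLp_two_iff_integrable_sq (f := fun v : ℝ => v) measurable_id.aestronglyMeasurable]
  refine ((integrable_const (1 : ℝ)).add hint).mono'
    (measurable_id.pow_const 2).aestronglyMeasurable (Eventually.of_forall fun v => ?_)
  rw [Real.norm_of_nonneg (sq_nonneg v)]
  simpa using pow_sq_le_one_add_pow_four v (m := 1) one_le_two

/-- The conditional moments of order `0`, `1` and `2` of a variable with mean `g` and
variance `σ2`. -/
def condMoment (g σ2 : ℝ → ℝ) (m : ℕ) (t : ℝ) : ℝ :=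
  match m with
  | 0 => 1
  | 1 => g t
  | _ => σ2 t + g t ^ 2

/-! ### From the sampling assumption to local limits -/

namespace SamplingAssumption

variable {Ω : Type*} [MeasurableSpace Ω] {P : Measure Ω} [IsProbabilityMeasure P]
  {x y : ℕ → Ω → ℝ} {f g σ2 : ℝ → ℝ} {N A : Set ℝ} {t₀ : ℝ} {p : ℕ}
  (hS : SamplingAssumption P x y f g σ2 N t₀ p)
include hS

lemma condMoment_eq {m : ℕ} (hm : m ≤ 2) : ∀ᵐ t ∂(P.map (x 0)), t ∈ N →
    ∫ v, v ^ m ∂(condDistrib (y 0) (x 0) P t) = condMoment g σ2 m t := by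
  obtain ⟨M, hM⟩ := hS.fourth_moment
  filter_upwards [hS.regression, hS.condVariance, hM] with t h1 h2 h4 ht
  have hL2 := memLp_two_id_of_fourth_moment ((h4 ht).trans_lt ENNReal.coe_lt_top)
  interval_cases m
  · simp [condMoment]
  · simp [condMoment, h1]
  · simp only [condMoment]
    rw [h2 ht, variance_eq_sub hL2, ← h1]
    simp

lemma continuousOn_condMoment (m : ℕ) :
    ContinuousOn (condMoment g σ2 m) (N ∩ (P.map (x 0)).support) := by
  have hg := hS.contDiffOn_g.continuousOn
  match m with
  | 0 => exact continuousOn_const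
  | 1 => exact hg
  | (m + 2) => exact hS.continuousOn_σ2.add (hg.pow 2)

variable (hA : LocalShape (P.map (x 0)).support t₀ A) {h : ℕ → ℝ} (hh : ∀ n, 0 < h n)
  (hlim : Tendsto h atTop (𝓝 0))
include hA hh hlim

lemma tendsto_mean {m : ℕ} (hm : m ≤ 2) {φ : ℝ → ℝ} (hφ : IsTest φ) :
    Tendsto (fun n => (h n)⁻¹ * ∫ t, φ ((t - t₀) / h n) *
      (∫ v, v ^ m ∂(condDistrib (y 0) (x 0) P t)) ∂(P.map (x 0))) atTop
      (𝓝 (f t₀ * condMoment g σ2 m t₀ * ∫ u in A, φ u)) :=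
  tendsto_local_mean hS.measurable_f hS.f_nonneg hS.density hS.continuousOn_f hS.isOpen_N hS.mem_N
    hA hh hlim (hS.continuousOn_condMoment m) (hS.condMoment_eq hm) hφ

/-- The case m = 0 of `tendsto_mean`, applied to an indicator: a window of width proportional to h
has mass O(h). -/
lemma exists_measure_le (R : ℝ) : ∃ C : ℝ, 0 ≤ C ∧ ∀ᶠ n in atTop,
    P.map (x 0) ((fun t => (t - t₀) / h n) ⁻¹' Icc (-R) R) ≤ ENNReal.ofReal (C * h n) := by
  have hprob : IsProbabilityMeasure (P.map (x 0)) :=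
    Measure.isProbabilityMeasure_map (hS.measurable_x 0).aemeasurable
  have h1 := hS.tendsto_mean hA hh hlim (m := 0) (by norm_num) (IsTest.of_indicator_Icc (-R) R)
  set D := f t₀ * condMoment g σ2 0 t₀ * ∫ u in A, (Icc (-R) R).indicator (fun _ => (1 : ℝ)) u
  refine ⟨|D| + 1, by positivity, ?_⟩
  have hD : D < |D| + 1 := (le_abs_self D).trans_lt (lt_add_one _)
  filter_upwards [h1.eventually (gt_mem_nhds hD)] with n hn
  have hm : MeasurableSet ((fun t => (t - t₀) / h n) ⁻¹' Icc (-R) R) :=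
    (by fun_prop : Measurable fun t => (t - t₀) / h n) measurableSet_Icc
  have h2 : ∫ t, (Icc (-R) R).indicator (fun _ => (1 : ℝ)) ((t - t₀) / h n) *
      (∫ v, v ^ 0 ∂(condDistrib (y 0) (x 0) P t)) ∂(P.map (x 0))
      = (P.map (x 0)).real ((fun t => (t - t₀) / h n) ⁻¹' Icc (-R) R) := by
    rw [← integral_indicator_one hm]
    congr 1; funext t
    simp only [pow_zero, integral_const, probReal_univ, smul_eq_mul, mul_one]
    rfl
  rw [h2] at hn
  rw [← ofReal_measureReal]
  refine ENNReal.ofReal_le_ofReal ?_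
  have h3 : (h n)⁻¹ * (P.map (x 0)).real ((fun t => (t - t₀) / h n) ⁻¹' Icc (-R) R) * h n
      ≤ (|D| + 1) * h n := mul_le_mul_of_nonneg_right hn.le (hh n).le
  rwa [mul_comm (h n)⁻¹, inv_mul_cancel_right₀ (hh n).ne'] at h3

/-- Conditioning on x bounds the second moment by the mass of the window times a bound for E[1 + y⁴
| x]. The fourth moment is what the case m = 2 requires, and it is controlled once the window lies
in N. -/
lemma exists_second_moment_le {m : ℕ} (hm : m ≤ 2) {φ : ℝ → ℝ} (hφ : IsTest φ) :
    ∃ C : ℝ, 0 ≤ C ∧ ∀ᶠ n in atTop,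
      ∫⁻ ω, ENNReal.ofReal ((φ ((x 0 ω - t₀) / h n) * y 0 ω ^ m) ^ 2) ∂P
        ≤ ENNReal.ofReal (C * h n) := by
  obtain ⟨B, hB⟩ := hφ.bdd
  obtain ⟨R, hR⟩ := hφ.supp
  obtain ⟨C, hC, hmeas⟩ := hS.exists_measure_le hA hh hlim R
  obtain ⟨M, hM⟩ := hS.fourth_moment
  obtain ⟨δ, hδ, hball⟩ := Metric.isOpen_iff.1 hS.isOpen_N t₀ hS.mem_N
  refine ⟨B ^ 2 * (1 + M) * C, by positivity, ?_⟩
  have hRh : Tendsto (fun n => (|R| + 1) * h n) atTop (𝓝 0) := by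
    simpa using hlim.const_mul (|R| + 1)
  filter_upwards [hmeas, hRh.eventually (gt_mem_nhds hδ)] with n hn hnδ
  set I := (fun t => (t - t₀) / h n) ⁻¹' Icc (-R) R with hI
  have hIm : MeasurableSet I :=
    (by fun_prop : Measurable fun t => (t - t₀) / h n) measurableSet_Icc
  have hIN : ∀ t ∈ I, t ∈ N := by
    intro t ht
    have ht' : |(t - t₀) / h n| ≤ R := abs_le.2 ht
    apply hball
    rw [Metric.mem_ball, Real.dist_eq]
    rw [abs_div, abs_of_pos (hh n), div_le_iff₀ (hh n)] at ht'
    have := mul_le_mul_of_nonneg_right (le_abs_self R) (hh n).le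
    linarith [hh n]
  let G : ℝ × ℝ → ℝ≥0∞ := fun q =>
    ENNReal.ofReal (B ^ 2) * (I.indicator (fun _ => 1) q.1 * (1 + ENNReal.ofReal (q.2 ^ 4)))
  have hGm : Measurable G := by
    have : Measurable (I.indicator fun _ => (1 : ℝ≥0∞)) := measurable_const.indicator hIm
    fun_prop
  have hle : ∀ ω, ENNReal.ofReal ((φ ((x 0 ω - t₀) / h n) * y 0 ω ^ m) ^ 2)
      ≤ G (x 0 ω, y 0 ω) := by
    intro ω
    by_cases hx : x 0 ω ∈ I
    · simp only [G, indicator_of_mem hx, one_mul]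
      rw [mul_pow, ENNReal.ofReal_mul (sq_nonneg _)]
      refine mul_le_mul' (ENNReal.ofReal_le_ofReal (sq_le_sq' ?_ ?_)) ?_
      · exact (abs_le.1 (hB _)).1
      · exact (abs_le.1 (hB _)).2
      · rw [← ENNReal.ofReal_one, ← ENNReal.ofReal_add zero_le_one (by positivity)]
        exact ENNReal.ofReal_le_ofReal (pow_sq_le_one_add_pow_four _ hm)
    · have : φ ((x 0 ω - t₀) / h n) = 0 := hR _ (not_le.1 fun hc => hx (abs_le.1 hc))
      simp [this]
  calc ∫⁻ ω, ENNReal.ofReal ((φ ((x 0 ω - t₀) / h n) * y 0 ω ^ m) ^ 2) ∂P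
      ≤ ∫⁻ ω, G (x 0 ω, y 0 ω) ∂P := lintegral_mono hle
    _ = ∫⁻ t, ∫⁻ v, G (t, v) ∂(condDistrib (y 0) (x 0) P t) ∂(P.map (x 0)) := by
      rw [← Measure.lintegral_compProd hGm,
        compProd_map_condDistrib (hS.measurable_y 0).aemeasurable,
        lintegral_map hGm ((hS.measurable_x 0).prodMk (hS.measurable_y 0))]
    _ ≤ ∫⁻ t, ENNReal.ofReal (B ^ 2) * (1 + M) * I.indicator (fun _ => 1) t ∂(P.map (x 0)) := by
      refine lintegral_mono_ae ?_
      filter_upwards [hM] with t ht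
      by_cases htI : t ∈ I
      · simp only [G, indicator_of_mem htI, one_mul, mul_one]
        rw [lintegral_const_mul _ (by fun_prop), lintegral_add_left measurable_const]
        gcongr
        · simp
        · exact ht (hIN t htI)
      · simp [G, indicator_of_notMem htI]
    _ = ENNReal.ofReal (B ^ 2) * (1 + M) * P.map (x 0) I := by
      rw [lintegral_const_mul _ (measurable_const.indicator hIm), lintegral_indicator_const hIm,
        one_mul]
    _ ≤ ENNReal.ofReal (B ^ 2) * (1 + M) * ENNReal.ofReal (C * h n) := by gcongr
    _ = ENNReal.ofReal (B ^ 2 * (1 + M) * C * h n) := by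
      rw [mul_assoc _ C, ENNReal.ofReal_mul (p := B ^ 2 * (1 + M)) (by positivity),
        ENNReal.ofReal_mul (p := B ^ 2) (by positivity), ENNReal.ofReal_add zero_le_one M.coe_nonneg, ENNReal.ofReal_one, ENNReal.ofReal_coe_nnreal]

lemma empTendsto (hnh : Tendsto (fun n : ℕ => (n : ℝ) * h n) atTop atTop) {m : ℕ} (hm : m ≤ 2) :
    EmpTendsto (probFilter P) (fun q => q.1) (fun q => h q.1)
      (scaledObs (fun q => h q.1) (fun q i => x i q.2) t₀) (fun q i => y i q.2 ^ m) A
      (f t₀ * condMoment g σ2 m t₀) := by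
  intro φ hφ
  have hu : ∀ n, Measurable fun q : ℝ × ℝ => φ ((q.1 - t₀) / h n) * q.2 ^ m := fun n =>
    (hφ.measurable.comp (by fun_prop)).mul (by fun_prop)
  have hpair : ∀ i, Measurable fun ω => (x i ω, y i ω) := fun i =>
    (hS.measurable_x i).prodMk (hS.measurable_y i)
  obtain ⟨C, hC, hsec⟩ := hS.exists_second_moment_le hA hh hlim hm hφ
  have hL2 : ∀ᶠ n in atTop, MemLp (fun ω => φ ((x 0 ω - t₀) / h n) * y 0 ω ^ m) 2 P := by
    filter_upwards [hsec] with n hn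
    have hmeas : Measurable fun ω => φ ((x 0 ω - t₀) / h n) * y 0 ω ^ m := (hu n).comp (hpair 0)
    rw [memLp_two_iff_integrable_sq hmeas.aestronglyMeasurable]
    exact ⟨(hmeas.pow_const 2).aestronglyMeasurable,
      (hasFiniteIntegral_iff_ofReal (Eventually.of_forall fun _ => sq_nonneg _)).2
        (hn.trans_lt ENNReal.ofReal_lt_top)⟩
  refine tendsto_probFilter_average (Z := fun n i ω => φ ((x i ω - t₀) / h n) * y i ω ^ m) (C := C)
    hh hnh ?_ ?_ hL2 ?_ ?_
  · exact fun n i j hij => (hS.indep.indepFun hij).comp (hu n) (hu n)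
  · exact fun n i => (hS.identDistrib i).comp (hu n)
  · filter_upwards [hsec] with n hn
    have hmeas : Measurable fun ω => φ ((x 0 ω - t₀) / h n) * y 0 ω ^ m := (hu n).comp (hpair 0)
    rw [integral_eq_lintegral_of_nonneg_ae (Eventually.of_forall fun _ => sq_nonneg _)
      (hmeas.pow_const 2).aestronglyMeasurable]
    exact ENNReal.toReal_le_of_le_ofReal (mul_nonneg hC (hh n).le) hn
  · refine (hS.tendsto_mean hA hh hlim hm hφ).congr' ?_
    filter_upwards [hL2] with n hn
    congr 1
    have hint : Integrable (fun q : ℝ × ℝ => φ ((q.1 - t₀) / h n) * q.2 ^ m)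
        (P.map (x 0) ⊗ₘ condDistrib (y 0) (x 0) P) := by
      rw [compProd_map_condDistrib (hS.measurable_y 0).aemeasurable,
        integrable_map_measure (hu n).aestronglyMeasurable (hpair 0).aemeasurable]
      exact hn.integrable one_le_two
    have h1 := Measure.integral_compProd hint
    rw [compProd_map_condDistrib (hS.measurable_y 0).aemeasurable,
      integral_map (hpair 0).aemeasurable (hu n).aestronglyMeasurable] at h1
    rw [h1]
    simp only [integral_const_mul]

/-- Almost surely all observations lie in the support, which near t₀ is t₀ + A; the cone property
removes the scale h. -/
lemma eventually_scaledObs_mem (R : ℝ) : ∀ᶠ q in probFilter P, ∀ j < q.1,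
    |scaledObs (fun q : ℕ × Ω => h q.1) (fun q i => x i q.2) t₀ q j| ≤ R →
      scaledObs (fun q : ℕ × Ω => h q.1) (fun q i => x i q.2) t₀ q j ∈ A := by
  obtain ⟨δ, hδ, hshape⟩ := hA.mem_iff
  have hsupp : ∀ i, ∀ᵐ ω ∂P, x i ω ∈ (P.map (x 0)).support := fun i => by
    have hid : IdentDistrib (x i) (x 0) P P := (hS.identDistrib i).comp measurable_fst
    refine hid.symm.ae_snd Measure.isClosed_support.measurableSet ?_
    exact ae_of_ae_map (hS.measurable_x 0).aemeasurable Measure.support_mem_ae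
  have hRh : Tendsto (fun n => (|R| + 1) * h n) atTop (𝓝 0) := by
    simpa using hlim.const_mul (|R| + 1)
  refine eventually_probFilter_of_ae ?_
  filter_upwards [hRh.eventually (gt_mem_nhds hδ)] with n hn
  filter_upwards [ae_all_iff.2 hsupp] with ω hω j _ hj
  simp only [scaledObs] at hj ⊢
  have hj' := hj
  rw [abs_div, abs_of_pos (hh n), div_le_iff₀ (hh n)] at hj
  have h1 := mul_le_mul_of_nonneg_right (le_abs_self R) (hh n).le
  have h2 : |x j ω - t₀| < δ := by linarith [hh n]
  have h3 := (hshape _ h2).1 (hω j)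
  rw [← hA.mul_mem_iff _ (hh n), mul_div_cancel₀ _ (hh n).ne']
  exact h3

/-- Along the filter of convergence in probability, the sample has the local limits given by the
density, the regression function and the conditional variance at `t₀`. -/
theorem localLimits (hnh : Tendsto (fun n : ℕ => (n : ℝ) * h n) atTop atTop) :
    LocalLimits (probFilter P) (fun q => q.1) (fun q => h q.1) (fun q i => x i q.2)
      (fun q i => y i q.2) t₀ A (f t₀) (g t₀) (σ2 t₀ + g t₀ ^ 2) := by
  have h0 := hS.empTendsto hA hh hlim hnh (m := 0) (by norm_num)
  have h1 := hS.empTendsto hA hh hlim hnh (m := 1) (by norm_num)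
  have h2 := hS.empTendsto hA hh hlim hnh (m := 2) le_rfl
  simp only [pow_zero, pow_one, condMoment, mul_one] at h0 h1 h2
  have hn : Tendsto (fun q : ℕ × Ω => q.1) (probFilter P) atTop :=
    tendsto_fst_probFilter (F := fun n => n) tendsto_id
  have hnh' : Tendsto (fun q : ℕ × Ω => (q.1 : ℝ) * h q.1) (probFilter P) atTop :=
    tendsto_fst_probFilter (F := fun n : ℕ => (n : ℝ) * h n) hnh
  exact ⟨fun q => hh q.1, hn, hnh', hA.isClosed_A, hA.zero_mem, hA.add_mem,
    hS.f_pos t₀ ⟨hS.mem_N, hA.mem_center⟩, hS.eventually_scaledObs_mem hA hh hlim, h0, h1, h2⟩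

end SamplingAssumption

/-! ### The limiting weights -/

section LimitWeights

variable {K : ℝ → ℝ} (hK : IsKernelLike K) (hpos : ∀ u ∈ Ioo (-1 : ℝ) 1, 0 < K u)
include hK hpos

section Positivity

variable {A : Set ℝ} (hA : IsClosed A) (h0 : (0 : ℝ) ∈ A) (hadd : ∀ s ∈ A, ∀ u, 0 ≤ u → s + u ∈ A)
include hA hadd

lemma setIntegral_eqKernel_shift (p : ℕ) {s : ℝ} (hs : s ∈ A) :
    ∫ u in shiftSet A s, eqKernel K p (shiftSet A s) u = 1 :=
  setIntegral_eqKernel hK hpos (measurable_const_add s hA.measurableSet)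
    (fun u hu => hadd s hs u hu.1.le) p

include h0

lemma setIntegral_eqKernel_zero (p : ℕ) : ∫ u in A, eqKernel K p (shiftSet A 0) u = 1 := by
  have := setIntegral_eqKernel_shift hK hpos hA hadd p h0
  rwa [shiftSet_zero] at this ⊢

/-- By Fubini the u-integral is taken first. For fixed s in A it is the integral of the equivalent
kernel of A - s over its own domain, which equals one, and the outer kernel then has integral one as
well. -/
lemma setIntegral_convOn (p : ℕ) : ∫ u in A, convOn K p A u = 1 := by
  have ht := isTest_eqCoeff hK hpos hA hadd p
  have hw := isTest_eqKernel hK p (shiftSet A 0)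
  set a : Fin (p + 1) → ℝ → ℝ := fun k s => eqKernel K p (shiftSet A 0) s *
    (A ∩ Icc (-1) 1).indicator (fun s => eqCoeff K p (shiftSet A s) k) s with ha
  have hat : ∀ k, IsTest (a k) := fun k => hw.mul (ht k)
  have hprod : ∀ k, Integrable (fun q : ℝ × ℝ => a k q.2 * monoKernel K k (q.1 - q.2))
      ((volume.restrict A).prod (volume.restrict A)) := fun k => by
    rw [Measure.prod_restrict]
    exact ((hat k).integrable.convolution_integrand (ContinuousLinearMap.mul ℝ ℝ)
      (isKernelLike_monoKernel hK k).isTest.integrable).integrableOn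
  have hmom : ∀ k : Fin (p + 1), ∀ s, ∫ u in A, a k s * monoKernel K k (u - s)
      = a k s * ∫ u in shiftSet A s, monoKernel K k u := fun k s => by
    rw [integral_const_mul, setIntegral_comp_sub]
  calc ∫ u in A, convOn K p A u
      = ∫ u in A, ∑ k : Fin (p + 1), ∫ s in A, a k s * monoKernel K k (u - s) := by
        simp only [convOn_eq_sum hK hA p ht, ha]
    _ = ∑ k : Fin (p + 1), ∫ u in A, ∫ s in A, a k s * monoKernel K k (u - s) :=
        integral_finsetSum _ fun k _ => (hprod k).integral_prod_left
    _ = ∑ k : Fin (p + 1), ∫ s in A, a k s * ∫ u in shiftSet A s, monoKernel K k u := by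
        refine Finset.sum_congr rfl fun k _ => ?_
        rw [integral_integral_swap (hprod k)]
        simp only [hmom]
    _ = ∫ s in A, ∑ k : Fin (p + 1), a k s * ∫ u in shiftSet A s, monoKernel K k u := by
        refine (integral_finsetSum _ fun k _ => ?_).symm
        have := (hprod k).integral_prod_right
        simpa only [hmom] using this
    _ = ∫ s in A, eqKernel K p (shiftSet A 0) s := by
        refine setIntegral_congr_fun hA.measurableSet fun s hs => ?_
        by_cases h1 : s ∈ Icc (-1 : ℝ) 1
        · have h2 := setIntegral_eqKernel_shift hK hpos hA hadd p hs
          have h3 := setIntegral_eqKernel_mul_pow (B := shiftSet A s) hK p 0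
          simp only [pow_zero, mul_one, add_zero, h2] at h3
          simp only [ha, indicator_of_mem (show s ∈ A ∩ Icc (-1) 1 from ⟨hs, h1⟩), mul_assoc,
            monoKernel]
          rw [← Finset.mul_sum, ← h3, mul_one]
        · have h2 : eqKernel K p (shiftSet A 0) s = 0 :=
            eqKernel_eq_zero hK p _ (not_lt.1 fun h => h1 (abs_le.1 h.le))
          simp [ha, h2]
    _ = 1 := setIntegral_eqKernel_zero hK hpos hA h0 hadd p

lemma setIntegral_wLimit (p : ℕ) (q : ℝ) : ∫ u in A, wLimit K p A q u = 1 := by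
  have hw := (isTest_eqKernel hK p (shiftSet A 0)).integrable.integrableOn (s := A)
  have hc := (isTest_convOn hK hpos hA hadd p).integrable.integrableOn (s := A)
  have h1 : ∫ u in A, (convOn K p A u - eqKernel K p (shiftSet A 0) u) = 0 := by
    rw [integral_sub hc hw, setIntegral_convOn hK hpos hA h0 hadd,
      setIntegral_eqKernel_zero hK hpos hA h0 hadd, sub_self]
  have h2 := integral_sub hw ((hc.sub hw).const_mul q)
  simp only [Pi.sub_apply] at h2
  unfold wLimit
  rw [h2, integral_const_mul,
    setIntegral_eqKernel_zero hK hpos hA h0 hadd, h1, mul_zero, sub_zero]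

/-- A vanishing integral of the square would make the weight zero almost everywhere on A,
contradicting its integral one. -/
lemma setIntegral_wLimit_sq_pos (p : ℕ) (q : ℝ) : 0 < ∫ u in A, wLimit K p A q u ^ 2 := by
  have ht := isTest_wLimit (p := p) hK hpos hA hadd q
  have hint : IntegrableOn (fun u => wLimit K p A q u ^ 2) A := by
    simpa only [sq] using (ht.mul ht).integrable.integrableOn (s := A)
  refine lt_of_le_of_ne (integral_nonneg fun u => sq_nonneg _) fun hz => ?_
  have h2 := (integral_eq_zero_iff_of_nonneg (fun u => sq_nonneg _) hint).1 hz.symm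
  have h3 : ∫ u in A, wLimit K p A q u = 0 := by
    refine integral_eq_zero_of_ae ?_
    filter_upwards [h2] with u hu
    exact pow_eq_zero_iff two_ne_zero |>.1 hu
  rw [setIntegral_wLimit hK hpos hA h0 hadd] at h3
  exact one_ne_zero h3

end Positivity

omit hK hpos in
lemma wLimit_univ (K : ℝ → ℝ) (p : ℕ) : wLimit K p univ 1 = wPLP K p := by
  funext u
  simp only [wLimit, wPLP, convOn, wConv, wInt, shiftSet, preimage_univ, setIntegral_univ, one_mul]

/-- The line is translation invariant, so the bias constant does not depend on the evaluation point
and averaging it against a kernel of integral one leaves it unchanged. -/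
lemma biasConstLP_univ (p : ℕ) : biasConstLP K p univ = biasConst K p univ 0 := by
  have h1 := setIntegral_eqKernel_zero hK hpos isClosed_univ (mem_univ 0)
    (fun _ _ _ _ => trivial) p
  have h2 : ∀ s, biasConst K p univ s = biasConst K p univ 0 := fun s => by
    simp only [biasConst, shiftSet, preimage_univ]
  rw [biasConstLP]
  simp only [h2]
  rw [integral_mul_const, h1, one_mul]

lemma biasConst_univ_ne_zero (hsymm : ∀ u, K (-u) = K u) {p : ℕ} (hp : Odd p) :
    biasConst K p univ 0 ≠ 0 := by
  have := integral_eqKernel_mul_pow_ne_zero hK hpos hsymm hp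
  simpa only [biasConst, shiftSet_zero, setIntegral_univ] using this

omit hpos in
-- The moments over [-s, ∞) and [-s, 1] agree because the kernel vanishes beyond 1.
lemma eqKernel_shift_Ici (p : ℕ) (s u : ℝ) :
    eqKernel K p (shiftSet (Ici 0) s) u = wBnd K p u s := by
  have h1 : shiftSet (Ici 0) s = Ici (-s) := by
    ext v; simp [shiftSet, neg_le_iff_add_nonneg']
  have h2 : kernelMoment K p (Ici (-s)) = kernelMoment K p (Icc (-s) 1) := by
    ext j k
    simp only [kernelMoment, Matrix.of_apply]
    refine (setIntegral_eq_of_subset_of_forall_sdiff_eq_zero measurableSet_Ici Icc_subset_Ici_self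
      fun v hv => ?_)
    have : ¬ v ≤ 1 := fun h => hv.2 ⟨hv.1, h⟩
    rw [hK.zero v fun h => this h.2.le, mul_zero]
  rw [h1, wBnd, eqKernel, eqKernel, h2]

omit hpos in
lemma wBnd_eq_zero (p : ℕ) (s : ℝ) {u : ℝ} (hu : 1 ≤ u) : wBnd K p u s = 0 :=
  eqKernel_eq_zero hK p _ (hu.trans (le_abs_self u))

omit hK hpos in
lemma setIntegral_Ici_eq_intervalIntegral {a : ℝ} (ha : a ≤ 1) {φ : ℝ → ℝ}
    (hφ : ∀ u, 1 ≤ u → φ u = 0) : ∫ u in Ici a, φ u = ∫ u in a..1, φ u := by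
  rw [integral_Ici_eq_integral_Ioi, intervalIntegral.integral_of_le ha]
  refine (setIntegral_eq_of_subset_of_forall_sdiff_eq_zero measurableSet_Ioi Ioc_subset_Ioi_self
    fun u hu => hφ u ?_)
  exact le_of_not_ge fun h => hu.2 ⟨hu.1, h⟩

omit hpos in
lemma biasConst_Ici {s : ℝ} (hs : 0 ≤ s) (p : ℕ) :
    biasConst K p (Ici 0) s = ∫ u in (-s)..1, wBnd K p u s * u ^ (p + 1) := by
  have h1 : shiftSet (Ici 0) s = Ici (-s) := by
    ext v; simp [shiftSet, neg_le_iff_add_nonneg']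
  simp only [biasConst, eqKernel_shift_Ici hK]
  rw [h1]
  exact setIntegral_Ici_eq_intervalIntegral (by linarith)
    fun u hu => by rw [wBnd_eq_zero hK p s hu, zero_mul]

omit hpos in
lemma biasConst_Ici_zero (p : ℕ) : biasConst K p (Ici 0) 0 = CBnd K p := by
  simp only [biasConst, CBnd, eqKernel_shift_Ici hK]
  rw [shiftSet_zero]

omit hpos in
lemma biasConstLP_Ici (p : ℕ) : biasConstLP K p (Ici 0) = CLPBnd K p := by
  simp only [biasConstLP, CLPBnd, eqKernel_shift_Ici hK]
  rw [setIntegral_Ici_eq_intervalIntegral zero_le_one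
    fun u hu => by rw [wBnd_eq_zero hK p 0 hu, zero_mul]]
  refine intervalIntegral.integral_congr fun s hs => ?_
  rw [uIcc_of_le zero_le_one] at hs
  simp only [biasConst_Ici hK hs.1]

omit hpos in
lemma wLimit_Ici (p : ℕ) : wLimit K p (Ici 0) (CBnd K p / CLPBnd K p) = wMPLPBnd K p := by
  funext u
  simp only [wLimit, wMPLPBnd, convOn, wConvBnd, eqKernel_shift_Ici hK]

end LimitWeights

end LocPoly

end

/-! ### The consistency theorem -/

theorem lemma1 {Ω : Type*} [MeasurableSpace Ω] (P : Measure Ω) [IsProbabilityMeasure P]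
    (x y : ℕ → Ω → ℝ) (f g σ2 : ℝ → ℝ) (N : Set ℝ) (t₀ : ℝ) (p : ℕ) (K : ℝ → ℝ) (h : ℕ → ℝ)
    (κ : ℝ) (hp : Odd p) (hS : SamplingAssumption P x y f g σ2 N t₀ p)
    (hK : KernelBandwidthAssumption K h κ p) (k : HCType) :
    -- interior point: consistency of the PLP estimator
    (IsInteriorPoint (P.map (x 0)).support t₀ →
      0 < vSqPLP K p (f t₀) (σ2 t₀) ∧
      TendstoInMeasure P
        (fun n ω => vHatSqPLP k K p n (h n) (fun i => x i ω) (fun i => y i ω) t₀)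
        atTop (fun _ => vSqPLP K p (f t₀) (σ2 t₀))) ∧
    -- interior point: consistency of the mPLP estimator, with the same limit
    (IsInteriorPoint (P.map (x 0)).support t₀ →
      TendstoInMeasure P
        (fun n ω => vHatSqMPLP k K p n (h n) (fun i => x i ω) (fun i => y i ω) t₀)
        atTop (fun _ => vSqPLP K p (f t₀) (σ2 t₀))) ∧
    -- boundary point: consistency of the mPLP estimator
    (IsLeftBoundaryPoint (P.map (x 0)).support t₀ → CLPBnd K p ≠ 0 →
      0 < vSqMPLPBnd K p (f t₀) (σ2 t₀) ∧
      TendstoInMeasure P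
        (fun n ω => vHatSqMPLP k K p n (h n) (fun i => x i ω) (fun i => y i ω) t₀)
        atTop (fun _ => vSqMPLPBnd K p (f t₀) (σ2 t₀))) := by
  have hKl := hK.isKernelLike
  have hpos := hK.K_pos
  have hlim := hK.tendsto_h
  have hratio : ∀ {A : Set ℝ}, LocalShape (P.map (x 0)).support t₀ A → 0 < σ2 t₀ / f t₀ :=
    fun hA => div_pos (hS.σ2_pos t₀ ⟨hS.mem_N, hA.mem_center⟩)
      (hS.f_pos t₀ ⟨hS.mem_N, hA.mem_center⟩)
  refine ⟨fun hint => ?_, fun hint => ?_, fun hbnd hC => ?_⟩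
  · have hA := LocalShape.interior hint
    have hD := hS.localLimits hA hK.h_pos hlim hK.tendsto_nh
    refine ⟨?_, tendstoInMeasure_of_tendsto_probFilter ?_⟩
    · have h1 := setIntegral_wLimit_sq_pos hKl hpos hA.isClosed_A hA.zero_mem hA.add_mem p 1
      rw [wLimit_univ, setIntegral_univ] at h1
      exact mul_pos (hratio hA) h1
    -- PLP is the scaling factor q = 1; the second moment limit σ² + g² minus g² leaves σ².
    · have h1 := hD.tendsto_variance (p := p) hKl hpos k (q := fun _ => 1) tendsto_const_nhds
      simp only [wLimit_univ, setIntegral_univ, add_sub_cancel_right, one_mul] at h1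
      exact h1
  · have hA := LocalShape.interior hint
    have hD := hS.localLimits hA hK.h_pos hlim hK.tendsto_nh
    refine tendstoInMeasure_of_tendsto_probFilter ?_
    have hne := biasConst_univ_ne_zero hKl hpos hK.K_symm hp
    have hLP := biasConstLP_univ hKl hpos p
    have hQ := hD.tendsto_Qn (p := p) hKl hpos (by rwa [hLP])
    -- On the whole line the two bias constants agree and are nonzero, so the random factor Q_n
    -- tends to 1, the PLP value.
    rw [hLP, div_self hne] at hQ
    have h1 := hD.tendsto_variance (p := p) hKl hpos k hQ
    simp only [wLimit_univ, setIntegral_univ, add_sub_cancel_right] at h1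
    exact h1
  · have hA := LocalShape.leftBoundary hbnd
    have hD := hS.localLimits hA hK.h_pos hlim hK.tendsto_nh
    refine ⟨?_, tendstoInMeasure_of_tendsto_probFilter ?_⟩
    · have h1 := setIntegral_wLimit_sq_pos hKl hpos hA.isClosed_A hA.zero_mem hA.add_mem p
        (CBnd K p / CLPBnd K p)
      rw [wLimit_Ici hKl] at h1
      exact mul_pos (hratio hA) h1
    · have hQ := hD.tendsto_Qn (p := p) hKl hpos (by rwa [biasConstLP_Ici hKl])
      rw [biasConstLP_Ici hKl, biasConst_Ici_zero hKl] at hQ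
      have h1 := hD.tendsto_variance (p := p) hKl hpos k hQ
      simp only [wLimit_Ici hKl, add_sub_cancel_right] at h1
      exact h1
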